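/- **Setting.** Let $C$ be a small category with a Grothendieck topology $J$. Let $\mathbf{Set}_0\subset\mathbf{Set}_1$ be the small sets and the sets of the next universe, so that the set of small sheaves on a small site is a $1$-set. For $A\in C$ let $J/A$ be the induced topology on the slice $C/A$, let $\mathrm{Sh}_0(C/A)$ be the category of small sheaves on $(C/A,J/A)$, and let $\Omega_A$ be its sheaf of closed sieves (the subobject classifier). A map $h\colon B\to A$ acts by precomposition with $C/h\colon C/B\to C/A$, and $\Omega_A\circ (C/h)$ is identified with $\Omega_B$ by $S\mapsto\{k \mid (C/h)(k)\in S\}$. *The internal universe.* $\mathrm{Univ}$ is the category internal to $1$-presheaves on $C$ with $\mathrm{Univ}_0(A)=\mathrm{ob}\,\mathrm{Sh}_0(C/A)$ and $\mathrm{Univ}_1(A)=\{(F,G,\gamma)\mid \gamma\colon F\to G \text{ in } \mathrm{Sh}_0(C/A)\}$. *Predicates.* $\mathrm{Pred}$ is the category internal to $1$-presheaves on $C$ with $\mathrm{Pred}_0(A)=\{(F,\alpha)\mid F\in\mathrm{Sh}_0(C/A),\ \alpha\colon F\to\Omega_A\}$ and with $\mathrm{Pred}_1(A)$ the set of triples $((F,\alpha),(G,\beta),\gamma)$,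 where $\gamma\colon F\to G$ and $\alpha$ entails $\beta$ along $\gamma$: $\alpha\le\beta\circ\gamma$ in the pointwise order of $\Omega_A$. Let $p\colon\mathrm{Pred}\to\mathrm{Univ}$ be the internal functor $(F,\alpha)\mapsto F$. *Fibres.* For a global section $X\colon 1\to\mathrm{Univ}_0$, the internal fibre $\mathrm{Pred}_X$ has as object of objects the pullback of $p_0$ along $X$ and as object of morphisms the pullback of $p_1$ along $e\circ X$ (with $e$ the identity-assigning map of $\mathrm{Univ}$); $\iota_X\colon\mathrm{Pred}_X\to\mathrm{Pred}$ is the inclusion. *Cartesian and opcartesian 2-cells.* Let $Z$ be an internal category and $a',a\colon Z\to\mathrm{Pred}$ internal functors. An internal natural transformation $\alpha\colon a'\Rightarrow a$ is *$p$-cartesian* if for all internal functors $x\colon W\to Z$, $a''\colon W\to\mathrm{Pred}$ and all 2-cells $\xi\colon a''\Rightarrow a x$ and $\gamma\colon pa''\Rightarrow pa'x$ with $p\xi=(p\alpha x)\circ\gamma$ there is a unique 2-cell $\zeta\colon a''\Rightarrow a'x$ with $p\zeta=\gamma$ and $\xi=(\alpha x)\circ\zeta$. Dually, $\alpha\colon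 a\Rightarrow a'$ is *$p$-opcartesian* if for all such $x$, $a''$ and all $\xi\colon ax\Rightarrow a''$ and $\gamma\colon pa'x\Rightarrow pa''$ with $p\xi=\gamma\circ(p\alpha x)$ there is a unique $\zeta\colon a'x\Rightarrow a''$ with $p\zeta=\gamma$ and $\xi=\zeta\circ(\alpha x)$. **Theorem.** Let $X,Y\colon 1\to\mathrm{Univ}_0$ be global sections and let $f\colon 1\to\mathrm{Univ}_1$ be a morphism from $X$ to $Y$, i.e. $s\circ f=X$ and $t\circ f=Y$. Then $\mathrm{Pred}_X$ and $\mathrm{Pred}_Y$ are categories internal to $1$-sheaves on $(C,J)$, and: 1. (Reindexing) There is a unique internal functor $f^*\colon\mathrm{Pred}_Y\to\mathrm{Pred}_X$ for which there exists a $p$-cartesian 2-cell $\alpha\colon\iota_X f^*\Rightarrow\iota_Y$ above $f$, i.e. such that the component of $p\alpha$ is $(\mathrm{Pred}_Y)_0\to 1\xrightarrow{f}\mathrm{Univ}_1$. 2. (Existential quantification) There is a unique internal functor $\exists^f\colon\mathrm{Pred}_X\to\mathrm{Pred}_Y$ for which there exists a $p$-opcartesian 2-cell $\alpha\colon\iota_X\Rightarrow\iota_Y\exists^f$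 above $f$, i.e. such that the component of $p\alpha$ is $(\mathrm{Pred}_X)_0\to 1\xrightarrow{f}\mathrm{Univ}_1$. -/

import Mathlib

open CategoryTheory CategoryTheory.Limits Opposite

universe v u

attribute [local simp] pullback.lift_fst pullback.lift_fst_assoc pullback.lift_snd
  pullback.lift_snd_assoc

/-! ## The 2-category of categories internal to a category with pullbacks -/

/-- A category internal to `E`. The pullback `pullback s t` consists of the composable pairs
`(g, f)` with `s g = t f`: its first projection is `g`, its second one is `f`, and `c (g, f)` is
the composite of `g` after `f`. Associativity is stated for generalised elements `h, g, f`. -/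
structure IntCat (E : Type u) [Category.{v} E] [HasPullbacks E] where
  obj₀ : E
  obj₁ : E
  s : obj₁ ⟶ obj₀
  t : obj₁ ⟶ obj₀
  e : obj₀ ⟶ obj₁
  c : pullback s t ⟶ obj₁
  e_s : e ≫ s = 𝟙 obj₀
  e_t : e ≫ t = 𝟙 obj₀
  c_s : c ≫ s = pullback.snd s t ≫ s
  c_t : c ≫ t = pullback.fst s t ≫ t
  comp_id : pullback.lift (𝟙 obj₁) (s ≫ e) (by simp [e_t]) ≫ c = 𝟙 obj₁
  id_comp : pullback.lift (t ≫ e) (𝟙 obj₁) (by simp [e_s]) ≫ c = 𝟙 obj₁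
  assoc : ∀ {T : E} (h g f : T ⟶ obj₁) (hg : h ≫ s = g ≫ t) (gf : g ≫ s = f ≫ t),
    pullback.lift h (pullback.lift g f gf ≫ c) (by simp [c_t, hg]) ≫ c =
      pullback.lift (pullback.lift h g hg ≫ c) f (by simp [c_s, gf]) ≫ c

namespace IntCat

variable {E : Type u} [Category.{v} E] [HasPullbacks E]

/-- The composite of generalised morphisms: `g` after `f`. -/
noncomputable def mul (A : IntCat E) {T : E} (g f : T ⟶ A.obj₁) (h : g ≫ A.s = f ≫ A.t) :
    T ⟶ A.obj₁ :=
  pullback.lift g f h ≫ A.c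

section mul

variable (A : IntCat E) {T T' : E}

lemma mul_s (g f : T ⟶ A.obj₁) (h : g ≫ A.s = f ≫ A.t) : A.mul g f h ≫ A.s = f ≫ A.s := by
  simp [mul, A.c_s]

lemma mul_t (g f : T ⟶ A.obj₁) (h : g ≫ A.s = f ≫ A.t) : A.mul g f h ≫ A.t = g ≫ A.t := by
  simp [mul, A.c_t]

lemma precomp_mul (x : T' ⟶ T) (g f : T ⟶ A.obj₁) (h : g ≫ A.s = f ≫ A.t) :
    x ≫ A.mul g f h = A.mul (x ≫ g) (x ≫ f) (by simp [h]) := by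
  simp only [mul, ← Category.assoc]
  congr 1
  apply pullback.hom_ext <;> simp

lemma mul_assoc (h g f : T ⟶ A.obj₁) (hg : h ≫ A.s = g ≫ A.t) (gf : g ≫ A.s = f ≫ A.t) :
    A.mul h (A.mul g f gf) (by rw [mul_t, hg]) = A.mul (A.mul h g hg) f (by rw [mul_s, gf]) :=
  A.assoc h g f hg gf

lemma mul_id (f : T ⟶ A.obj₁) :
    A.mul f (f ≫ A.s ≫ A.e) (by simp [A.e_t]) = f := by
  have h := A.precomp_mul f (𝟙 _) (A.s ≫ A.e) (by simp [A.e_t])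
  rw [show A.mul (𝟙 _) (A.s ≫ A.e) (by simp [A.e_t]) = 𝟙 _ from A.comp_id] at h
  simpa using h.symm

lemma id_mul (f : T ⟶ A.obj₁) :
    A.mul (f ≫ A.t ≫ A.e) f (by simp [A.e_s]) = f := by
  have h := A.precomp_mul f (A.t ≫ A.e) (𝟙 _) (by simp [A.e_s])
  rw [show A.mul (A.t ≫ A.e) (𝟙 _) (by simp [A.e_s]) = 𝟙 _ from A.id_comp] at h
  simpa using h.symm

lemma mul_congr {g g' f f' : T ⟶ A.obj₁} (hg : g = g') (hf : f = f') (h : g ≫ A.s = f ≫ A.t) :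
    A.mul g f h = A.mul g' f' (by rw [← hg, ← hf, h]) := by
  subst hg hf; rfl

end mul

end IntCat

/-- An internal functor. -/
@[ext]
structure IntFunctor {E : Type u} [Category.{v} E] [HasPullbacks E] (A B : IntCat E) where
  f₀ : A.obj₀ ⟶ B.obj₀
  f₁ : A.obj₁ ⟶ B.obj₁
  comm_s : f₁ ≫ B.s = A.s ≫ f₀
  comm_t : f₁ ≫ B.t = A.t ≫ f₀
  comm_e : A.e ≫ f₁ = f₀ ≫ B.e
  comm_c : A.c ≫ f₁ = pullback.lift (pullback.fst A.s A.t ≫ f₁) (pullback.snd A.s A.t ≫ f₁)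
    (by rw [Category.assoc, Category.assoc, comm_s, comm_t, pullback.condition_assoc]) ≫ B.c

namespace IntFunctor

variable {E : Type u} [Category.{v} E] [HasPullbacks E] {A B D : IntCat E}

lemma mul_comp (F : IntFunctor A B) {T : E} (g f : T ⟶ A.obj₁) (h : g ≫ A.s = f ≫ A.t) :
    A.mul g f h ≫ F.f₁ = B.mul (g ≫ F.f₁) (f ≫ F.f₁)
      (by rw [Category.assoc, Category.assoc, F.comm_s, F.comm_t, reassoc_of% h]) := by
  simp only [IntCat.mul, Category.assoc, F.comm_c]
  simp only [← Category.assoc]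
  congr 1
  apply pullback.hom_ext <;> simp

/-- Composition of internal functors, in diagrammatic order. -/
noncomputable def comp (F : IntFunctor A B) (G : IntFunctor B D) : IntFunctor A D where
  f₀ := F.f₀ ≫ G.f₀
  f₁ := F.f₁ ≫ G.f₁
  comm_s := by rw [Category.assoc, G.comm_s, reassoc_of% F.comm_s]
  comm_t := by rw [Category.assoc, G.comm_t, reassoc_of% F.comm_t]
  comm_e := by rw [reassoc_of% F.comm_e, G.comm_e, Category.assoc]
  comm_c := by
    rw [← Category.assoc, F.comm_c]
    exact (G.mul_comp (pullback.fst A.s A.t ≫ F.f₁) (pullback.snd A.s A.t ≫ F.f₁)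
      (by rw [Category.assoc, Category.assoc, F.comm_s, F.comm_t, pullback.condition_assoc])).trans
      (D.mul_congr (Category.assoc _ _ _) (Category.assoc _ _ _) _)

end IntFunctor

/-- An internal natural transformation `F ⇒ G`. The naturality square says that
`G(a) ∘ α_{s a} = α_{t a} ∘ F(a)`. -/
@[ext]
structure IntNatTrans {E : Type u} [Category.{v} E] [HasPullbacks E] {A B : IntCat E}
    (F G : IntFunctor A B) where
  app : A.obj₀ ⟶ B.obj₁
  app_s : app ≫ B.s = F.f₀
  app_t : app ≫ B.t = G.f₀
  naturality :
    pullback.lift G.f₁ (A.s ≫ app) (by rw [Category.assoc, app_t, G.comm_s]) ≫ B.c =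
      pullback.lift (A.t ≫ app) F.f₁ (by rw [Category.assoc, app_s, F.comm_t]) ≫ B.c

namespace IntNatTrans

variable {E : Type u} [Category.{v} E] [HasPullbacks E] {A B D : IntCat E}

lemma nat {F G : IntFunctor A B} (α : IntNatTrans F G) :
    B.mul G.f₁ (A.s ≫ α.app) (by rw [Category.assoc, α.app_t, G.comm_s]) =
      B.mul (A.t ≫ α.app) F.f₁ (by rw [Category.assoc, α.app_s, F.comm_t]) :=
  α.naturality

/-- Vertical composition, in diagrammatic order: first `α`, then `β`. -/
noncomputable def vcomp {F G H : IntFunctor A B} (α : IntNatTrans F G) (β : IntNatTrans G H) :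
    IntNatTrans F H where
  app := B.mul β.app α.app (by rw [β.app_s, α.app_t])
  app_s := by rw [B.mul_s, α.app_s]
  app_t := by rw [B.mul_t, β.app_t]
  naturality := by
    have h₁ : H.f₁ ≫ B.s = (A.s ≫ β.app) ≫ B.t := by rw [Category.assoc, β.app_t, H.comm_s]
    have h₂ : (A.s ≫ β.app) ≫ B.s = (A.s ≫ α.app) ≫ B.t := by simp [β.app_s, α.app_t]
    have h₃ : (A.t ≫ β.app) ≫ B.s = (A.t ≫ α.app) ≫ B.t := by simp [β.app_s, α.app_t]
    have h₄ : (A.t ≫ α.app) ≫ B.s = F.f₁ ≫ B.t := by rw [Category.assoc, α.app_s, F.comm_t]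
    have h₅ : (A.t ≫ β.app) ≫ B.s = G.f₁ ≫ B.t := by rw [Category.assoc, β.app_s, G.comm_t]
    have h₆ : G.f₁ ≫ B.s = (A.s ≫ α.app) ≫ B.t := by rw [Category.assoc, α.app_t, G.comm_s]
    change B.mul _ _ _ = B.mul _ _ _
    rw [B.mul_congr rfl (B.precomp_mul A.s β.app α.app _),
      B.mul_congr (B.precomp_mul A.t β.app α.app _) rfl]
    rw [B.mul_assoc _ _ _ h₁ h₂, ← B.mul_assoc _ _ _ h₃ h₄,
      B.mul_congr β.nat rfl, ← B.mul_assoc _ _ _ h₅ h₆, B.mul_congr rfl α.nat]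

/-- Whiskering `α x` of a 2-cell `α` with a 1-cell `x` into its domain. -/
noncomputable def whiskerLeft (x : IntFunctor D A) {F G : IntFunctor A B}
    (α : IntNatTrans F G) : IntNatTrans (x.comp F) (x.comp G) where
  app := x.f₀ ≫ α.app
  app_s := by rw [Category.assoc, α.app_s]; rfl
  app_t := by rw [Category.assoc, α.app_t]; rfl
  naturality := by
    change B.mul (x.f₁ ≫ G.f₁) _ _ = B.mul _ (x.f₁ ≫ F.f₁) _
    refine (B.mul_congr rfl (f' := x.f₁ ≫ A.s ≫ α.app)
      (by rw [reassoc_of% x.comm_s]) _).trans ?_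
    refine Eq.trans ?_ (B.mul_congr (g := x.f₁ ≫ A.t ≫ α.app)
      (by rw [reassoc_of% x.comm_t]) rfl
      (by rw [Category.assoc, Category.assoc, Category.assoc, α.app_s, F.comm_t]))
    rw [← B.precomp_mul _ _ _ (by rw [Category.assoc, α.app_t, G.comm_s]), α.nat, B.precomp_mul]

/-- Whiskering `p α` of a 2-cell `α` with a 1-cell `p` out of its codomain. -/
noncomputable def whiskerRight {F G : IntFunctor A B} (α : IntNatTrans F G)
    (p : IntFunctor B D) : IntNatTrans (F.comp p) (G.comp p) where
  app := α.app ≫ p.f₁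
  app_s := by rw [Category.assoc, p.comm_s, reassoc_of% α.app_s]; rfl
  app_t := by rw [Category.assoc, p.comm_t, reassoc_of% α.app_t]; rfl
  naturality := by
    change D.mul (G.f₁ ≫ p.f₁) _ _ = D.mul _ (F.f₁ ≫ p.f₁) _
    refine (D.mul_congr rfl (Category.assoc A.s α.app p.f₁).symm _).trans ?_
    refine Eq.trans ?_ (D.mul_congr (Category.assoc A.t α.app p.f₁) rfl
      (by rw [Category.assoc, Category.assoc, Category.assoc, p.comm_s, p.comm_t,
        reassoc_of% α.app_s, reassoc_of% F.comm_t]))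
    rw [← p.mul_comp _ _ (by rw [Category.assoc, α.app_t, G.comm_s]), α.nat, p.mul_comp]

/-- A 2-cell `α : e' ⇒ e` is `p`-cartesian: for all `x`, `e''`, `ξ : e'' ⇒ e x` and
`γ : p e'' ⇒ p e' x` with `p ξ = p α x ∘ γ` there is a unique `ζ : e'' ⇒ e' x` with `p ζ = γ` and
`ξ = α x ∘ ζ`. -/
def IsCartesian {X P U : IntCat E} (p : IntFunctor P U) {e' e : IntFunctor X P}
    (α : IntNatTrans e' e) : Prop :=
  ∀ (Y : IntCat E) (x : IntFunctor Y X) (e'' : IntFunctor Y P)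
    (ξ : IntNatTrans e'' (x.comp e)) (γ : IntNatTrans (e''.comp p) ((x.comp e').comp p)),
    ξ.whiskerRight p = γ.vcomp ((α.whiskerLeft x).whiskerRight p) →
    ∃! ζ : IntNatTrans e'' (x.comp e'),
      ζ.whiskerRight p = γ ∧ ξ = ζ.vcomp (α.whiskerLeft x)

/-- A 2-cell `α : e ⇒ e'` is `p`-opcartesian: for all `x`, `e''`, `ξ : e x ⇒ e''` and
`γ : p e' x ⇒ p e''` with `p ξ = γ ∘ p α x` there is a unique `ζ : e' x ⇒ e''` with `p ζ = γ` and
`ξ = ζ ∘ α x`. -/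
def IsOpcartesian {X P U : IntCat E} (p : IntFunctor P U) {e e' : IntFunctor X P}
    (α : IntNatTrans e e') : Prop :=
  ∀ (Y : IntCat E) (x : IntFunctor Y X) (e'' : IntFunctor Y P)
    (ξ : IntNatTrans (x.comp e) e'') (γ : IntNatTrans ((x.comp e').comp p) (e''.comp p)),
    ξ.whiskerRight p = ((α.whiskerLeft x).whiskerRight p).vcomp γ →
    ∃! ζ : IntNatTrans (x.comp e') e'',
      ζ.whiskerRight p = γ ∧ ξ = (α.whiskerLeft x).vcomp ζ

end IntNatTrans

/-! ## Fibres of an internal functor over global sections -/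

namespace IntFunctor

variable {E : Type u} [Category.{v} E] [HasPullbacks E] [HasTerminal E] {P U : IntCat E}

lemma fibre_s_condition (p : IntFunctor P U) (X : ⊤_ E ⟶ U.obj₀) :
    (pullback.fst p.f₁ (X ≫ U.e) ≫ P.s) ≫ p.f₀ = pullback.snd p.f₁ (X ≫ U.e) ≫ X := by
  rw [Category.assoc, ← p.comm_s, pullback.condition_assoc, Category.assoc, U.e_s,
    Category.comp_id]

lemma fibre_t_condition (p : IntFunctor P U) (X : ⊤_ E ⟶ U.obj₀) :
    (pullback.fst p.f₁ (X ≫ U.e) ≫ P.t) ≫ p.f₀ = pullback.snd p.f₁ (X ≫ U.e) ≫ X := by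
  rw [Category.assoc, ← p.comm_t, pullback.condition_assoc, Category.assoc, U.e_t,
    Category.comp_id]

lemma fibre_e_condition (p : IntFunctor P U) (X : ⊤_ E ⟶ U.obj₀) :
    (pullback.fst p.f₀ X ≫ P.e) ≫ p.f₁ = pullback.snd p.f₀ X ≫ X ≫ U.e := by
  rw [Category.assoc, p.comm_e, pullback.condition_assoc]

/-- The source map of the fibre over `X`. -/
noncomputable def fibreS (p : IntFunctor P U) (X : ⊤_ E ⟶ U.obj₀) :
    pullback p.f₁ (X ≫ U.e) ⟶ pullback p.f₀ X :=
  pullback.lift (pullback.fst _ _ ≫ P.s) (pullback.snd _ _) (p.fibre_s_condition X)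

/-- The target map of the fibre over `X`. -/
noncomputable def fibreT (p : IntFunctor P U) (X : ⊤_ E ⟶ U.obj₀) :
    pullback p.f₁ (X ≫ U.e) ⟶ pullback p.f₀ X :=
  pullback.lift (pullback.fst _ _ ≫ P.t) (pullback.snd _ _) (p.fibre_t_condition X)

lemma fibreS_fst (p : IntFunctor P U) (X : ⊤_ E ⟶ U.obj₀) :
    p.fibreS X ≫ pullback.fst _ _ = pullback.fst _ _ ≫ P.s :=
  pullback.lift_fst _ _ _

lemma fibreT_fst (p : IntFunctor P U) (X : ⊤_ E ⟶ U.obj₀) :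
    p.fibreT X ≫ pullback.fst _ _ = pullback.fst _ _ ≫ P.t :=
  pullback.lift_fst _ _ _

lemma fibre_composable (p : IntFunctor P U) (X : ⊤_ E ⟶ U.obj₀) {T : E}
    (g f : T ⟶ pullback p.f₁ (X ≫ U.e)) (h : g ≫ p.fibreS X = f ≫ p.fibreT X) :
    (g ≫ pullback.fst _ _) ≫ P.s = (f ≫ pullback.fst _ _) ≫ P.t := by
  rw [Category.assoc, Category.assoc, ← fibreS_fst, ← fibreT_fst, reassoc_of% h]

lemma fibre_c_condition (p : IntFunctor P U) (X : ⊤_ E ⟶ U.obj₀) {T : E}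
    (g f : T ⟶ pullback p.f₁ (X ≫ U.e)) (h : g ≫ p.fibreS X = f ≫ p.fibreT X) :
    P.mul (g ≫ pullback.fst _ _) (f ≫ pullback.fst _ _) (p.fibre_composable X g f h) ≫ p.f₁ =
      terminal.from T ≫ X ≫ U.e := by
  have key (k : T ⟶ pullback p.f₁ (X ≫ U.e)) :
      (k ≫ pullback.fst _ _) ≫ p.f₁ = terminal.from T ≫ X ≫ U.e := by
    rw [Category.assoc, pullback.condition, ← Category.assoc]
    congr 1
    subsingleton
  rw [p.mul_comp, U.mul_congr (key g) (key f)]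
  refine (U.mul_congr rfl ?_ _).trans (U.mul_id (terminal.from T ≫ X ≫ U.e))
  simp only [Category.assoc, reassoc_of% U.e_s]

/-- The composition map of the fibre over `X`. -/
noncomputable def fibreC (p : IntFunctor P U) (X : ⊤_ E ⟶ U.obj₀) :
    pullback (p.fibreS X) (p.fibreT X) ⟶ pullback p.f₁ (X ≫ U.e) :=
  pullback.lift
    (P.mul (pullback.fst _ _ ≫ pullback.fst _ _) (pullback.snd _ _ ≫ pullback.fst _ _)
      (p.fibre_composable X _ _ pullback.condition))
    (terminal.from _) (p.fibre_c_condition X _ _ pullback.condition)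

lemma fibreC_fst (p : IntFunctor P U) (X : ⊤_ E ⟶ U.obj₀) :
    p.fibreC X ≫ pullback.fst _ _ =
      P.mul (pullback.fst _ _ ≫ pullback.fst _ _) (pullback.snd _ _ ≫ pullback.fst _ _)
        (p.fibre_composable X _ _ pullback.condition) :=
  pullback.lift_fst _ _ _

lemma lift_fibreC_fst (p : IntFunctor P U) (X : ⊤_ E ⟶ U.obj₀) {T : E}
    (g f : T ⟶ pullback p.f₁ (X ≫ U.e)) (h : g ≫ p.fibreS X = f ≫ p.fibreT X) :
    (pullback.lift g f h ≫ p.fibreC X) ≫ pullback.fst _ _ =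
      P.mul (g ≫ pullback.fst _ _) (f ≫ pullback.fst _ _) (p.fibre_composable X g f h) := by
  rw [Category.assoc, fibreC_fst, P.precomp_mul]
  exact P.mul_congr (by simp) (by simp) _

/-- The fibre of `p : P → U` over a global section `X : 1 → U₀`: its object of objects is the
pullback of `p₀` along `X`, its object of morphisms the pullback of `p₁` along `e ∘ X`, and its
structure maps are those of `P`. -/
noncomputable def fibre (p : IntFunctor P U) (X : ⊤_ E ⟶ U.obj₀) : IntCat E where
  obj₀ := pullback p.f₀ X
  obj₁ := pullback p.f₁ (X ≫ U.e)
  s := p.fibreS X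
  t := p.fibreT X
  e := pullback.lift (pullback.fst _ _ ≫ P.e) (pullback.snd _ _) (p.fibre_e_condition X)
  c := p.fibreC X
  e_s := by
    apply pullback.hom_ext
    · rw [Category.assoc, fibreS_fst, pullback.lift_fst_assoc, Category.assoc, P.e_s,
        Category.comp_id, Category.id_comp]
    · subsingleton
  e_t := by
    apply pullback.hom_ext
    · rw [Category.assoc, fibreT_fst, pullback.lift_fst_assoc, Category.assoc, P.e_t,
        Category.comp_id, Category.id_comp]
    · subsingleton
  c_s := by
    apply pullback.hom_ext
    · simp only [Category.assoc, fibreS_fst]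
      rw [reassoc_of% p.fibreC_fst X, P.mul_s, Category.assoc]
    · subsingleton
  c_t := by
    apply pullback.hom_ext
    · simp only [Category.assoc, fibreT_fst]
      rw [reassoc_of% p.fibreC_fst X, P.mul_t, Category.assoc]
    · subsingleton
  comp_id := by
    apply pullback.hom_ext
    · refine (p.lift_fibreC_fst X _ _ _).trans ?_
      refine (P.mul_congr rfl ?_ _).trans (P.mul_id _)
      rw [Category.assoc, pullback.lift_fst, reassoc_of% p.fibreS_fst X, Category.id_comp]
    · subsingleton
  id_comp := by
    apply pullback.hom_ext
    · refine (p.lift_fibreC_fst X _ _ _).trans ?_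
      refine (P.mul_congr ?_ rfl _).trans (P.id_mul _)
      rw [Category.assoc, pullback.lift_fst, reassoc_of% p.fibreT_fst X, Category.id_comp]
    · subsingleton
  assoc h g f hg gf := by
    apply pullback.hom_ext
    · refine (p.lift_fibreC_fst X _ _ _).trans (Eq.trans ?_ (p.lift_fibreC_fst X _ _ _).symm)
      refine (P.mul_congr rfl (p.lift_fibreC_fst X g f gf) _).trans (Eq.trans ?_
        (P.mul_congr (p.lift_fibreC_fst X h g hg).symm rfl ?_))
      exact P.mul_assoc _ _ _ (p.fibre_composable X h g hg) (p.fibre_composable X g f gf)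
    · subsingleton

/-- The inclusion of the fibre over `X`. -/
noncomputable def fibreι (p : IntFunctor P U) (X : ⊤_ E ⟶ U.obj₀) :
    IntFunctor (p.fibre X) P where
  f₀ := pullback.fst _ _
  f₁ := pullback.fst _ _
  comm_s := (pullback.lift_fst _ _ _).symm
  comm_t := (pullback.lift_fst _ _ _).symm
  comm_e := pullback.lift_fst _ _ _
  comm_c := pullback.lift_fst _ _ _

end IntFunctor

/-! ## The internal category given by a strict presheaf of categories -/

section OfPresheaf

/-- Composition of `a : F → G` and `b : G → H` to `F → H`, for arrows whose middle objects are
equal. -/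
def arrowComp {D : Type*} [Category D] (b a : Arrow D) (h : b.left = a.right) : Arrow D :=
  Arrow.mk (a.hom ≫ eqToHom h.symm ≫ b.hom)

lemma arrowComp_map {D D' : Type*} [Category D] [Category D'] (H : D ⥤ D') (b a : Arrow D)
    (h : b.left = a.right) (h' : (H.mapArrow.obj b).left = (H.mapArrow.obj a).right) :
    H.mapArrow.obj (arrowComp b a h) = arrowComp (H.mapArrow.obj b) (H.mapArrow.obj a) h' := by
  obtain ⟨X, Y, a⟩ := a
  obtain ⟨Y', Z, b⟩ := b
  obtain rfl : Y' = Y := h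
  simp [arrowComp, Functor.mapArrow]

lemma arrowComp_congr {D : Type*} [Category D] {b b' a a' : Arrow D} (hb : b = b') (ha : a = a')
    (h : b.left = a.right) : arrowComp b a h = arrowComp b' a' (by rw [← hb, ← ha, h]) := by
  subst hb ha; rfl

lemma arrowComp_id {D : Type*} [Category D] (a : Arrow D) :
    arrowComp a (Arrow.mk (𝟙 a.left)) rfl = a := by
  change Arrow.mk (𝟙 _ ≫ 𝟙 _ ≫ a.hom) = a
  rw [Category.id_comp, Category.id_comp]
  rfl

lemma id_arrowComp {D : Type*} [Category D] (a : Arrow D) :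
    arrowComp (Arrow.mk (𝟙 a.right)) a rfl = a := by
  change Arrow.mk (a.hom ≫ 𝟙 _ ≫ 𝟙 _) = a
  rw [Category.comp_id, Category.comp_id]
  rfl

lemma arrowComp_assoc {D : Type*} [Category D] (d b a : Arrow D) (h : d.left = b.right)
    (h' : b.left = a.right) :
    arrowComp d (arrowComp b a h') h = arrowComp (arrowComp d b h) a h' := by
  simp [arrowComp]

lemma pullback_app_condition {K : Type*} [Category K] {F G H : K ⥤ Type v} (f : F ⟶ H)
    (g : G ⟶ H) [HasPullback f g] (A : K) (w : (pullback f g).obj A) :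
    f.app A ((pullback.fst f g).app A w) = g.app A ((pullback.snd f g).app A w) :=
  congrArg (fun k : pullback f g ⟶ H => k.app A w) pullback.condition

lemma pullback_app_lift_fst {K : Type*} [Category K] {F G H T : K ⥤ Type v} {f : F ⟶ H}
    {g : G ⟶ H} [HasPullback f g] (x : T ⟶ F) (y : T ⟶ G) (h : x ≫ f = y ≫ g) (A : K)
    (w : T.obj A) : (pullback.fst f g).app A ((pullback.lift x y h).app A w) = x.app A w :=
  congrArg (fun k : T ⟶ F => k.app A w) (pullback.lift_fst x y h)

lemma pullback_app_lift_snd {K : Type*} [Category K] {F G H T : K ⥤ Type v} {f : F ⟶ H}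
    {g : G ⟶ H} [HasPullback f g] (x : T ⟶ F) (y : T ⟶ G) (h : x ≫ f = y ≫ g) (A : K)
    (w : T.obj A) : (pullback.snd f g).app A ((pullback.lift x y h).app A w) = y.app A w :=
  congrArg (fun k : T ⟶ G => k.app A w) (pullback.lift_snd x y h)

lemma natTrans_app_map {K : Type*} [Category K] {F G : K ⥤ Type v} (f : F ⟶ G) {A B : K}
    (k : A ⟶ B) (w : F.obj A) : f.app B (F.map k w) = G.map k (f.app A w) :=
  congrArg (fun φ : F.obj A ⟶ G.obj B => φ w) (f.naturality k)

variable {C : Type u} [SmallCategory C]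

/-- The presheaf of objects of a strict presheaf of categories. -/
def objPresheaf (D : Cᵒᵖ ⥤ Cat.{u, u + 1}) : Cᵒᵖ ⥤ Type (u + 1) where
  obj A := D.obj A
  map f := ↾fun X => (D.map f).toFunctor.obj X
  map_id A := by ext X; simp
  map_comp f g := by ext X; simp

/-- The presheaf of morphisms, i.e. triples `(F, G, F → G)`, of a strict presheaf of
categories. -/
def arrowPresheaf (D : Cᵒᵖ ⥤ Cat.{u, u + 1}) : Cᵒᵖ ⥤ Type (u + 1) where
  obj A := Arrow (D.obj A)
  map f := ↾fun a => (D.map f).toFunctor.mapArrow.obj a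
  map_id A := by
    ext a
    exact congrArg (fun H : D.obj A ⟶ D.obj A => H.toFunctor.mapArrow.obj a) (D.map_id A)
  map_comp f g := by
    ext a
    exact congrArg (fun H : D.obj _ ⟶ D.obj _ => H.toFunctor.mapArrow.obj a) (D.map_comp f g)

/-- Source. -/
def arrowSource (D : Cᵒᵖ ⥤ Cat.{u, u + 1}) : arrowPresheaf D ⟶ objPresheaf D where
  app A := ↾fun a : Arrow (D.obj A) => a.left

/-- Target. -/
def arrowTarget (D : Cᵒᵖ ⥤ Cat.{u, u + 1}) : arrowPresheaf D ⟶ objPresheaf D where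
  app A := ↾fun a : Arrow (D.obj A) => a.right

/-- Identities. -/
def arrowId (D : Cᵒᵖ ⥤ Cat.{u, u + 1}) : objPresheaf D ⟶ arrowPresheaf D where
  app A := ↾fun X : D.obj A => Arrow.mk (𝟙 X)
  naturality A B f := by
    ext X
    exact (congrArg Arrow.mk ((D.map f).toFunctor.map_id X)).symm

/-- Composition. -/
noncomputable def arrowPresheafComp (D : Cᵒᵖ ⥤ Cat.{u, u + 1}) :
    pullback (arrowSource D) (arrowTarget D) ⟶ arrowPresheaf D where
  app A := ↾fun w => arrowComp ((pullback.fst (arrowSource D) (arrowTarget D)).app A w)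
    ((pullback.snd (arrowSource D) (arrowTarget D)).app A w) (pullback_app_condition _ _ A w)
  naturality A B f := by
    ext w
    refine (arrowComp_congr (natTrans_app_map (pullback.fst (arrowSource D) (arrowTarget D)) f w)
      (natTrans_app_map (pullback.snd (arrowSource D) (arrowTarget D)) f w)
      (pullback_app_condition (arrowSource D) (arrowTarget D) B _)).trans ?_
    exact (arrowComp_map (D.map f).toFunctor _ _
      (pullback_app_condition (arrowSource D) (arrowTarget D) A w) _).symm

lemma lift_arrowPresheafComp (D : Cᵒᵖ ⥤ Cat.{u, u + 1}) {T : Cᵒᵖ ⥤ Type (u + 1)}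
    (g f : T ⟶ arrowPresheaf D) (h : g ≫ arrowSource D = f ≫ arrowTarget D) (A : Cᵒᵖ)
    (w : T.obj A) :
    (pullback.lift g f h ≫ arrowPresheafComp D).app A w =
      arrowComp (g.app A w) (f.app A w)
        (congrArg (fun k : T ⟶ objPresheaf D => k.app A w) h) :=
  arrowComp_congr (pullback_app_lift_fst g f h A w) (pullback_app_lift_snd g f h A w)
    (pullback_app_condition (arrowSource D) (arrowTarget D) A _)

/-- A strict presheaf of categories `D` on `C`, viewed as a category internal to presheaves of
`1`-sets: at stage `A` its objects, morphisms, identities and composition are those of `D(A)`. -/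
noncomputable def IntCat.ofPresheaf (D : Cᵒᵖ ⥤ Cat.{u, u + 1}) :
    IntCat (Cᵒᵖ ⥤ Type (u + 1)) where
  obj₀ := objPresheaf D
  obj₁ := arrowPresheaf D
  s := arrowSource D
  t := arrowTarget D
  e := arrowId D
  c := arrowPresheafComp D
  e_s := rfl
  e_t := rfl
  c_s := rfl
  c_t := rfl
  comp_id := by
    ext A a
    exact (lift_arrowPresheafComp D _ _ _ A a).trans (arrowComp_id a)
  id_comp := by
    ext A a
    exact (lift_arrowPresheafComp D _ _ _ A a).trans (id_arrowComp a)
  assoc h g f hg gf := by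
    ext A a
    refine (lift_arrowPresheafComp D _ _ _ A a).trans (Eq.trans ?_
      (lift_arrowPresheafComp D _ _ _ A a).symm)
    refine (arrowComp_congr rfl (lift_arrowPresheafComp D g f gf A a) _).trans (Eq.trans ?_
      (arrowComp_congr (lift_arrowPresheafComp D h g hg A a).symm rfl
        (congrArg (fun k : _ ⟶ objPresheaf D => k.app A a) gf)))
    exact arrowComp_assoc (D := D.obj A) _ _ _ (congrArg (fun k : _ ⟶ objPresheaf D => k.app A a) hg)
      (congrArg (fun k : _ ⟶ objPresheaf D => k.app A a) gf)

/-- The internal functor given by a strict transformation of presheaves of categories. -/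
noncomputable def IntFunctor.ofPresheaf {D D' : Cᵒᵖ ⥤ Cat.{u, u + 1}} (τ : D ⟶ D') :
    IntFunctor (IntCat.ofPresheaf D) (IntCat.ofPresheaf D') where
  f₀ :=
    { app := fun A => ↾fun X => (τ.app A).toFunctor.obj X
      naturality := fun A B f => by
        ext X
        exact congrArg (fun H : D.obj A ⟶ D'.obj B => H.toFunctor.obj X) (τ.naturality f) }
  f₁ :=
    { app := fun A => ↾fun a => (τ.app A).toFunctor.mapArrow.obj a
      naturality := fun A B f => by
        ext a
        exact congrArg (fun H : D.obj A ⟶ D'.obj B => H.toFunctor.mapArrow.obj a)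
          (τ.naturality f) }
  comm_s := rfl
  comm_t := rfl
  comm_e := by
    ext A X
    exact congrArg Arrow.mk ((τ.app A).toFunctor.map_id X)
  comm_c := by
    ext A w
    refine Eq.trans ?_ (lift_arrowPresheafComp D' _ _ _ A w).symm
    exact arrowComp_map (τ.app A).toFunctor _ _
      (pullback_app_condition (arrowSource D) (arrowTarget D) A w) _

end OfPresheaf

/-! ## The universe and its predicates -/

section Site

variable {C : Type u} [SmallCategory C] {C' : Type u} [SmallCategory C']

/-- The subobject classifier of small sheaves: the sheaf of closed sieves. -/
def sheafOmega (K : GrothendieckTopology C) : Sheaf K (Type u) :=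
  ⟨(Functor.closedSieves K).toFunctor,
    (isSheaf_iff_isSheaf_of_type K _).2 (classifier_isSheaf K)⟩

/-- A predicate: a small sheaf `F` with a characteristic morphism `F → Ω`. -/
structure SheafPred (K : GrothendieckTopology C) where
  carrier : Sheaf K (Type u)
  char : carrier ⟶ sheafOmega K

/-- The truth value in `Ω(A)`, a sieve on `A`, of a predicate at `x ∈ F(A)`: the sieve of all
`h : B → A` such that the restriction of `x` along `h` satisfies the predicate. -/
def SheafPred.value {K : GrothendieckTopology C} (P : SheafPred K) {A : C}
    (x : P.carrier.obj.obj (op A)) : Sieve A :=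
  (P.char.hom.app (op A) x : ((Functor.closedSieves K).toFunctor.obj (op A))).1

/-- A morphism of predicates from `(F, α)` to `(G, β)`: a morphism `γ : F → G` such that `α`
entails `β` along `γ`, i.e. `α ≤ β ∘ γ` in the order of truth values. -/
@[ext]
structure SheafPred.Hom {K : GrothendieckTopology C} (P Q : SheafPred K) where
  hom : P.carrier ⟶ Q.carrier
  entails : ∀ (A : C) (x : P.carrier.obj.obj (op A)), P.value x ≤ Q.value (hom.hom.app (op A) x)

instance (K : GrothendieckTopology C) : Category (SheafPred K) where
  Hom P Q := SheafPred.Hom P Q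
  id P := ⟨𝟙 _, fun _ _ => le_rfl⟩
  comp f g := ⟨f.hom ≫ g.hom, fun A x => (f.entails A x).trans (g.entails A _)⟩

/-- The projection `(F, α) ↦ F`. -/
def SheafPred.forget (K : GrothendieckTopology C) : SheafPred K ⥤ Sheaf K (Type u) where
  obj P := P.carrier
  map f := f.hom

section Restriction

variable {K : GrothendieckTopology C} {K' : GrothendieckTopology C'}

lemma isClosed_functorPullback {H : C ⥤ C'} (hH : CoverPreserving K K' H) {A : C}
    (S : Sieve (H.obj A)) (hS : K'.IsClosed S) : K.IsClosed (S.functorPullback H) := by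
  intro B f hf
  refine hS (H.map f) ?_
  refine K'.superset_covering ?_ (hH.cover_preserve hf)
  rw [← Sieve.functorPullback_pullback, Sieve.functorPushforward_le_iff_le_functorPullback]

/-- The comparison map `Ω' ∘ H → Ω`, taking a closed sieve `S` on `H A` to the closed sieve
`{f | H f ∈ S}` on `A`. For the functors between slices used below it is an isomorphism. -/
def omegaRestrict (H : C ⥤ C') [H.IsContinuous K K'] (hH : CoverPreserving K K' H) :
    (H.sheafPushforwardContinuous (Type u) K K').obj (sheafOmega K') ⟶ sheafOmega K :=
  ⟨{ app := fun A => ↾fun (S : (Functor.closedSieves K').toFunctor.obj (op (H.obj A.unop))) =>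
      (⟨S.1.functorPullback H, isClosed_functorPullback hH S.1 S.2⟩ :
        (Functor.closedSieves K).toFunctor.obj A)
     naturality := fun A B f => by
      ext S
      exact Subtype.ext (Sieve.functorPullback_pullback H f.unop S.1) }⟩

/-- Restriction of predicates along a functor of sites:
`(F, α) ↦ (F ∘ H, F ∘ H → Ω' ∘ H → Ω)`. -/
def SheafPred.restrict (H : C ⥤ C') [H.IsContinuous K K'] (hH : CoverPreserving K K' H) :
    SheafPred K' ⥤ SheafPred K where
  obj P :=
    { carrier := (H.sheafPushforwardContinuous (Type u) K K').obj P.carrier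
      char := (H.sheafPushforwardContinuous (Type u) K K').map P.char ≫ omegaRestrict H hH }
  map f :=
    { hom := (H.sheafPushforwardContinuous (Type u) K K').map f.hom
      entails := fun A x => Sieve.functorPullback_monotone H A (f.entails (H.obj A) x) }

lemma SheafPred.restrict_congr {H H' : C ⥤ C'} [H.IsContinuous K K'] [H'.IsContinuous K K']
    (hH : CoverPreserving K K' H) (h : H = H') :
    SheafPred.restrict H hH = SheafPred.restrict H' (h ▸ hH) := by
  subst h; rfl

lemma sheafPushforwardContinuous_congr {H H' : C ⥤ C'} [H.IsContinuous K K']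
    [H'.IsContinuous K K'] (h : H = H') :
    H.sheafPushforwardContinuous (Type u) K K' =
      H'.sheafPushforwardContinuous (Type u) K K' := by
  subst h; rfl

end Restriction

variable (J : GrothendieckTopology C)

/-- The strict presheaf of categories `A ↦ Sh(C/A)` of small sheaves on slices, where
`f : B → A` acts by precomposition with `C/f : C/B → C/A`. -/
def univPresheaf : Cᵒᵖ ⥤ Cat.{u, u + 1} where
  obj A := Cat.of (Sheaf (J.over A.unop) (Type u))
  map f := ((Over.map f.unop).sheafPushforwardContinuous (Type u) _ _).toCatHom
  map_id A := by
    refine congrArg Functor.toCatHom ?_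
    exact sheafPushforwardContinuous_congr (Over.mapId_eq A.unop)
  map_comp f g := by
    refine congrArg Functor.toCatHom ?_
    have : (Over.map g.unop ⋙ Over.map f.unop).IsContinuous (J.over _) (J.over _) :=
      Functor.isContinuous_comp _ _ _ (J.over _) _
    exact sheafPushforwardContinuous_congr (Over.mapComp_eq g.unop f.unop)

/-- The strict presheaf of categories sending `A` to the category of predicates on sheaves on
`C/A`, with `f : B → A` acting by restriction along `C/f : C/B → C/A`. -/
def predPresheaf : Cᵒᵖ ⥤ Cat.{u, u + 1} where
  obj A := Cat.of (SheafPred (J.over A.unop))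
  map f := (SheafPred.restrict (Over.map f.unop) (J.over_map_coverPreserving f.unop)).toCatHom
  map_id A := by
    refine congrArg Functor.toCatHom ?_
    exact SheafPred.restrict_congr _ (Over.mapId_eq A.unop)
  map_comp f g := by
    refine congrArg Functor.toCatHom ?_
    have : (Over.map g.unop ⋙ Over.map f.unop).IsContinuous (J.over _) (J.over _) :=
      Functor.isContinuous_comp _ _ _ (J.over _) _
    exact SheafPred.restrict_congr _ (Over.mapComp_eq g.unop f.unop)

/-- The projections `(F, α) ↦ F`, for all `A`. -/
def predProjection : predPresheaf J ⟶ univPresheaf J where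
  app A := (SheafPred.forget (J.over A.unop)).toCatHom

/-- The internal universe: `Univ₀(A)` is the set of small sheaves on `C/A`, and `Univ₁(A)` is the
set of triples `(F, G, F → G)`. -/
noncomputable def Univ : IntCat (Cᵒᵖ ⥤ Type (u + 1)) :=
  IntCat.ofPresheaf (univPresheaf J)

/-- The internal category of predicates: `Pred₀(A)` is the set of pairs `(F, α : F → Ω)` of a
small sheaf on `C/A` and a characteristic morphism, `Pred₁(A)` the set of triples
`((F, α), (G, β), γ : F → G)` such that `α` entails `β` along `γ`. -/
noncomputable def Pred : IntCat (Cᵒᵖ ⥤ Type (u + 1)) :=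
  IntCat.ofPresheaf (predPresheaf J)

/-- The internal functor `p : Pred → Univ`. -/
noncomputable def predFunctor : IntFunctor (Pred J) (Univ J) :=
  IntFunctor.ofPresheaf (predProjection J)

/-- The internal category lies in `1`-sheaves, i.e. its objects of objects and of morphisms are
sheaves. Since sheaves form a full subcategory of presheaves that is closed under pullbacks, this
says that it is a category internal to sheaves; internal functors and natural transformations
between such categories are the same in sheaves and in presheaves. -/
def IntCat.IsSheaf (A : IntCat (Cᵒᵖ ⥤ Type (u + 1))) : Prop :=
  Presheaf.IsSheaf J A.obj₀ ∧ Presheaf.IsSheaf J A.obj₁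

end Site

/-!
The argument separates the 2-categorical part from the part about sheaves.

The projection `p` from predicates to sheaves is internally faithful, its fibres are partial orders,
and it is both a fibration and an opfibration at every stage: along `γ : F → G` a predicate on `G`
has the inverse image `β ∘ γ` (`SheafPred.inverseImage`), and a predicate on `F` has the direct
image, which holds at `y` if `y` is locally the image of an element satisfying the predicate
(`SheafPred.directImage`). Both are strictly stable under restriction along `C/h : C/B → C/A`;
for direct images this is a Beck–Chevalley condition, which holds since a sieve in `C/A` on an
object coming from `C/B` is covering if and only if its pullback to `C/B` is
(`SheafPred.restrictChar_image`). Hence every generalised object of `Pred` has cartesian and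
opcartesian lifts of generalised morphisms of `Univ`
(`exists_cartesian_lift`, `exists_opcartesian_lift`).

In any category with pullbacks and a terminal object, an internally faithful functor with
antisymmetric fibres and such lifts of `f` at the generic object of a fibre has unique functors
between the fibres with a cartesian, respectively opcartesian, 2-cell above `f`
(`IntFunctor.existsUnique_reindex`, `IntFunctor.existsUnique_exist`). As the fibres are internally
thin, functor laws are automatic; a 2-cell with (op)cartesian components is (op)cartesian because
faithfulness makes lifts unique and natural; and the universal property gives vertical
2-cells in both directions between two solutions, which therefore agree by antisymmetry.

The fibre over `X` has at stage `A` the predicates on the sheaf `X_A`. Such predicates are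
determined locally and a compatible family of them has an amalgamation, obtained by closing the union of the
family (`SheafPred.exists_amalgamation`); inequalities between them are local
(`SheafPred.exists_vertical_of_local`). Throughout, a predicate is handled through the
elements at which its truth value is maximal (`SheafPred.Holds`), which form a closed subpresheaf
and determine it.
-/

/-! ### Internally thin categories -/

section Thin

variable {E : Type u} [Category.{v} E] [HasPullbacks E]

/-- An internal category is thin if a generalised morphism is determined by its source and
target. -/
def IntCat.IsThin (A : IntCat E) : Prop :=
  ∀ ⦃T : E⦄ (a b : T ⟶ A.obj₁), a ≫ A.s = b ≫ A.s → a ≫ A.t = b ≫ A.t → a = b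

/-- The identity internal functor. -/
noncomputable def IntFunctor.id (A : IntCat E) : IntFunctor A A where
  f₀ := 𝟙 _
  f₁ := 𝟙 _
  comm_s := by simp
  comm_t := by simp
  comm_e := by simp
  comm_c := by
    rw [Category.comp_id]
    refine (Category.id_comp _).symm.trans ?_
    congr 1
    apply pullback.hom_ext <;> simp

/-- An internal functor into a thin category needs only to respect sources and targets. -/
noncomputable def IntFunctor.ofThin {A B : IntCat E} (hB : B.IsThin) (f₀ : A.obj₀ ⟶ B.obj₀)
    (f₁ : A.obj₁ ⟶ B.obj₁) (hs : f₁ ≫ B.s = A.s ≫ f₀) (ht : f₁ ≫ B.t = A.t ≫ f₀) :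
    IntFunctor A B where
  f₀ := f₀
  f₁ := f₁
  comm_s := hs
  comm_t := ht
  comm_e := hB _ _ (by rw [Category.assoc, hs, reassoc_of% A.e_s, Category.assoc, B.e_s,
    Category.comp_id]) (by rw [Category.assoc, ht, reassoc_of% A.e_t, Category.assoc, B.e_t,
    Category.comp_id])
  comm_c := hB _ _ (by simp [B.c_s, hs, reassoc_of% A.c_s])
    (by simp [B.c_t, ht, reassoc_of% A.c_t])

lemma IntFunctor.ext_of_isThin {A B : IntCat E} (hB : B.IsThin) {F G : IntFunctor A B}
    (h : F.f₀ = G.f₀) : F = G :=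
  IntFunctor.ext h (hB _ _ (by rw [F.comm_s, G.comm_s, h]) (by rw [F.comm_t, G.comm_t, h]))

end Thin

lemma comp_terminal_from_assoc {E : Type u} [Category.{v} E] [HasTerminal E]
    {T T' S : E} (x : T ⟶ T') (g : ⊤_ E ⟶ S) :
    x ≫ terminal.from T' ≫ g = terminal.from T ≫ g := by
  rw [← Category.assoc]
  congr 1
  subsingleton

/-! ### Internal functors with partially ordered fibres -/

namespace IntFunctor

section Lifts

variable {E : Type u} [Category.{v} E] [HasPullbacks E] {P U : IntCat E}

/-- An internal functor is faithful if a generalised morphism of its domain is determined by its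
source, its target and its image. -/
def IsFaithful (p : IntFunctor P U) : Prop :=
  ∀ ⦃T : E⦄ (a b : T ⟶ P.obj₁), a ≫ P.s = b ≫ P.s → a ≫ P.t = b ≫ P.t →
    a ≫ p.f₁ = b ≫ p.f₁ → a = b

/-- The fibres of `p` are antisymmetric: generalised objects related by vertical morphisms in both
directions are equal. -/
def IsFibrewiseAntisymm (p : IntFunctor P U) : Prop :=
  ∀ ⦃T : E⦄ (a b : T ⟶ P.obj₁), a ≫ P.s = b ≫ P.t → a ≫ P.t = b ≫ P.s →
    a ≫ p.f₁ = (a ≫ P.s) ≫ p.f₀ ≫ U.e → b ≫ p.f₁ = (b ≫ P.s) ≫ p.f₀ ≫ U.e →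
    a ≫ P.s = a ≫ P.t

/-- A generalised morphism `a` is `p`-cartesian if, at every later stage, a morphism `ξ` with the
same target whose image factors as `p a ∘ γ` lifts `γ` to a morphism from the source of `ξ` to that
of `a`. For faithful `p` this lift is unique and `ξ` is its composite with `a`. -/
def IsCartesianMor (p : IntFunctor P U) {T : E} (a : T ⟶ P.obj₁) : Prop :=
  ∀ ⦃T' : E⦄ (x : T' ⟶ T) (ξ : T' ⟶ P.obj₁) (γ : T' ⟶ U.obj₁)
    (h : (x ≫ a ≫ p.f₁) ≫ U.s = γ ≫ U.t), ξ ≫ P.t = x ≫ a ≫ P.t →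
    ξ ≫ p.f₁ = U.mul (x ≫ a ≫ p.f₁) γ h →
    ∃ ζ : T' ⟶ P.obj₁, ζ ≫ P.s = ξ ≫ P.s ∧ ζ ≫ P.t = x ≫ a ≫ P.s ∧ ζ ≫ p.f₁ = γ

/-- A generalised morphism `a` is `p`-opcartesian if, at every later stage, a morphism `ξ` with the
same source whose image factors as `γ ∘ p a` lifts `γ` to a morphism from the target of `a` to that
of `ξ`. -/
def IsOpcartesianMor (p : IntFunctor P U) {T : E} (a : T ⟶ P.obj₁) : Prop :=
  ∀ ⦃T' : E⦄ (x : T' ⟶ T) (ξ : T' ⟶ P.obj₁) (γ : T' ⟶ U.obj₁)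
    (h : γ ≫ U.s = (x ≫ a ≫ p.f₁) ≫ U.t), ξ ≫ P.s = x ≫ a ≫ P.s →
    ξ ≫ p.f₁ = U.mul γ (x ≫ a ≫ p.f₁) h →
    ∃ ζ : T' ⟶ P.obj₁, ζ ≫ P.s = x ≫ a ≫ P.t ∧ ζ ≫ P.t = ξ ≫ P.t ∧ ζ ≫ p.f₁ = γ

variable {p : IntFunctor P U} {Z : IntCat E}

/-- For faithful `p`, morphisms that form a natural transformation in `U` are natural in `P`. -/
noncomputable def IsFaithful.natTrans (hp : p.IsFaithful) {F G : IntFunctor Z P}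
    (γ : IntNatTrans (F.comp p) (G.comp p)) (ζ : Z.obj₀ ⟶ P.obj₁) (hs : ζ ≫ P.s = F.f₀)
    (ht : ζ ≫ P.t = G.f₀) (hζ : ζ ≫ p.f₁ = γ.app) : IntNatTrans F G where
  app := ζ
  app_s := hs
  app_t := ht
  naturality := by
    change P.mul _ _ _ = P.mul _ _ _
    apply hp
    · rw [P.mul_s, P.mul_s, Category.assoc, hs, F.comm_s]
    · rw [P.mul_t, P.mul_t, Category.assoc, ht, G.comm_t]
    · rw [p.mul_comp, p.mul_comp]
      refine Eq.trans (U.mul_congr rfl ?_ _) ((IntNatTrans.nat γ).trans (U.mul_congr ?_ rfl _))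
      · rw [Category.assoc, hζ]
      · rw [Category.assoc, hζ]

/-- A 2-cell with cartesian components is cartesian. -/
lemma IsFaithful.isCartesian (hp : p.IsFaithful) {F G : IntFunctor Z P} (α : IntNatTrans F G)
    (hα : p.IsCartesianMor α.app) : α.IsCartesian p := by
  intro W x H ξ γ h
  have h' : ξ.app ≫ p.f₁ = U.mul ((x.f₀ ≫ α.app) ≫ p.f₁) γ.app _ := congrArg IntNatTrans.app h
  obtain ⟨ζ, hζs, hζt, hζp⟩ := hα x.f₀ ξ.app γ.app
    (by rw [γ.app_t, ← Category.assoc]; exact ((α.whiskerLeft x).whiskerRight p).app_s)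
    (by rw [ξ.app_t, α.app_t]; rfl) (h'.trans (U.mul_congr (Category.assoc _ _ _) rfl _))
  refine ⟨hp.natTrans γ ζ (by rw [hζs, ξ.app_s]) (by rw [hζt, α.app_s]; rfl) hζp,
    ⟨IntNatTrans.ext hζp, IntNatTrans.ext (hp _ _ ?_ ?_ ?_)⟩, ?_⟩
  · exact (ξ.app_s).trans (IntNatTrans.app_s _).symm
  · exact (ξ.app_t).trans (IntNatTrans.app_t _).symm
  · rw [h']
    refine Eq.trans ?_ (p.mul_comp _ _ _).symm
    exact U.mul_congr rfl hζp.symm _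
  · rintro ζ' ⟨h₁, -⟩
    exact IntNatTrans.ext (hp _ _ (ζ'.app_s.trans (IntNatTrans.app_s _).symm)
      (ζ'.app_t.trans (IntNatTrans.app_t _).symm) ((congrArg IntNatTrans.app h₁).trans hζp.symm))

/-- A 2-cell with opcartesian components is opcartesian. -/
lemma IsFaithful.isOpcartesian (hp : p.IsFaithful) {F G : IntFunctor Z P} (α : IntNatTrans F G)
    (hα : p.IsOpcartesianMor α.app) : α.IsOpcartesian p := by
  intro W x H ξ γ h
  have h' : ξ.app ≫ p.f₁ = U.mul γ.app ((x.f₀ ≫ α.app) ≫ p.f₁) _ := congrArg IntNatTrans.app h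
  obtain ⟨ζ, hζs, hζt, hζp⟩ := hα x.f₀ ξ.app γ.app
    (by rw [γ.app_s, ← Category.assoc]; exact ((α.whiskerLeft x).whiskerRight p).app_t.symm)
    (by rw [ξ.app_s, α.app_s]; rfl) (h'.trans (U.mul_congr rfl (Category.assoc _ _ _) _))
  refine ⟨hp.natTrans γ ζ (by rw [hζs, α.app_t]; rfl) (by rw [hζt, ξ.app_t]) hζp,
    ⟨IntNatTrans.ext hζp, IntNatTrans.ext (hp _ _ ?_ ?_ ?_)⟩, ?_⟩
  · exact (ξ.app_s).trans (IntNatTrans.app_s _).symm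
  · exact (ξ.app_t).trans (IntNatTrans.app_t _).symm
  · rw [h']
    refine Eq.trans ?_ (p.mul_comp _ _ _).symm
    exact U.mul_congr hζp.symm rfl _
  · rintro ζ' ⟨h₁, -⟩
    exact IntNatTrans.ext (hp _ _ (ζ'.app_s.trans (IntNatTrans.app_s _).symm)
      (ζ'.app_t.trans (IntNatTrans.app_t _).symm) ((congrArg IntNatTrans.app h₁).trans hζp.symm))

end Lifts

section Fibres

variable {E : Type u} [Category.{v} E] [HasPullbacks E] [HasTerminal E] {P U : IntCat E}
  {p : IntFunctor P U} {X Y : ⊤_ E ⟶ U.obj₀}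

lemma fibreι_f₁_comp (p : IntFunctor P U) (X : ⊤_ E ⟶ U.obj₀) :
    (p.fibreι X).f₁ ≫ p.f₁ = terminal.from _ ≫ X ≫ U.e :=
  pullback.condition.trans (congrArg (· ≫ X ≫ U.e) (by subsingleton))

lemma fibreι_f₀_comp (p : IntFunctor P U) (X : ⊤_ E ⟶ U.obj₀) :
    (p.fibreι X).f₀ ≫ p.f₀ = terminal.from _ ≫ X :=
  pullback.condition.trans (congrArg (· ≫ X) (by subsingleton))

lemma fibre_hom_ext₀ {T : E} {a b : T ⟶ (p.fibre X).obj₀}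
    (h : a ≫ (p.fibreι X).f₀ = b ≫ (p.fibreι X).f₀) : a = b :=
  pullback.hom_ext h (by subsingleton)

lemma fibre_hom_ext₁ {T : E} {a b : T ⟶ (p.fibre X).obj₁}
    (h : a ≫ (p.fibreι X).f₁ = b ≫ (p.fibreι X).f₁) : a = b :=
  pullback.hom_ext h (by subsingleton)

lemma fibre_lift₀ {T : E} (a : T ⟶ P.obj₀) (h : a ≫ p.f₀ = terminal.from _ ≫ X) :
    ∃ l : T ⟶ (p.fibre X).obj₀, l ≫ (p.fibreι X).f₀ = a :=
  ⟨pullback.lift a (terminal.from _) h, pullback.lift_fst _ _ _⟩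

lemma fibre_lift₁ {T : E} (a : T ⟶ P.obj₁) (h : a ≫ p.f₁ = terminal.from _ ≫ X ≫ U.e) :
    ∃ l : T ⟶ (p.fibre X).obj₁, l ≫ (p.fibreι X).f₁ = a :=
  ⟨pullback.lift a (terminal.from _) h, pullback.lift_fst _ _ _⟩

/-- The fibres of a faithful internal functor are internal preorders. -/
lemma IsFaithful.fibre_isThin (hp : p.IsFaithful) (X : ⊤_ E ⟶ U.obj₀) : (p.fibre X).IsThin := by
  intro T a b hs ht
  refine fibre_hom_ext₁ (hp _ _ ?_ ?_ ?_)
  · rw [Category.assoc, Category.assoc, (p.fibreι X).comm_s, reassoc_of% hs]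
  · rw [Category.assoc, Category.assoc, (p.fibreι X).comm_t, reassoc_of% ht]
  · rw [Category.assoc, Category.assoc, fibreι_f₁_comp, comp_terminal_from_assoc,
      comp_terminal_from_assoc]

lemma mul_terminal_from_left {T : E} {f : ⊤_ E ⟶ U.obj₁} {Y : ⊤_ E ⟶ U.obj₀} (ht : f ≫ U.t = Y)
    {g k : T ⟶ U.obj₁} (h : g ≫ U.s = k ≫ U.t) (hg : g = terminal.from _ ≫ Y ≫ U.e)
    (hk : k = terminal.from _ ≫ f) : U.mul g k h = terminal.from _ ≫ f := by
  refine (U.mul_congr ?_ hk _).trans (U.id_mul _)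
  rw [hg, Category.assoc, reassoc_of% ht]

lemma mul_terminal_from_right {T : E} {f : ⊤_ E ⟶ U.obj₁} {X : ⊤_ E ⟶ U.obj₀} (hs : f ≫ U.s = X)
    {g k : T ⟶ U.obj₁} (h : g ≫ U.s = k ≫ U.t) (hg : g = terminal.from _ ≫ f)
    (hk : k = terminal.from _ ≫ X ≫ U.e) : U.mul g k h = terminal.from _ ≫ f := by
  refine (U.mul_congr hg ?_ _).trans (U.mul_id _)
  rw [hk, Category.assoc, reassoc_of% hs]

/-- A global morphism `f : X → Y` of `U` is a 2-cell between functors whose images in `U` are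
constant at `X` and at `Y`. -/
noncomputable def constTrans {Z : IntCat E} {F G : IntFunctor Z U} (f : ⊤_ E ⟶ U.obj₁)
    (hF : F.f₀ = terminal.from _ ≫ f ≫ U.s) (hG : G.f₀ = terminal.from _ ≫ f ≫ U.t)
    (hF₁ : F.f₁ = terminal.from _ ≫ (f ≫ U.s) ≫ U.e)
    (hG₁ : G.f₁ = terminal.from _ ≫ (f ≫ U.t) ≫ U.e) : IntNatTrans F G where
  app := terminal.from _ ≫ f
  app_s := by rw [hF, Category.assoc]
  app_t := by rw [hG, Category.assoc]
  naturality := by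
    change U.mul _ _ _ = U.mul _ _ _
    rw [mul_terminal_from_left rfl _ hG₁ (comp_terminal_from_assoc _ _),
      mul_terminal_from_right rfl _ (comp_terminal_from_assoc _ _) hF₁]

/-- The identity 2-cell of the constant functor at `X`. -/
noncomputable def constIdTrans {Z : IntCat E} {F G : IntFunctor Z U} (X : ⊤_ E ⟶ U.obj₀)
    (hF : F.f₀ = terminal.from _ ≫ X) (hG : G.f₀ = terminal.from _ ≫ X)
    (hF₁ : F.f₁ = terminal.from _ ≫ X ≫ U.e) (hG₁ : G.f₁ = terminal.from _ ≫ X ≫ U.e) :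
    IntNatTrans F G :=
  constTrans (X ≫ U.e) (by simpa [U.e_s] using hF) (by simpa [U.e_t] using hG)
    (by simpa [reassoc_of% U.e_s] using hF₁) (by simpa [reassoc_of% U.e_t] using hG₁)

lemma comp_fibreι_comp_f₀ {T : E} (F : T ⟶ (p.fibre X).obj₀) :
    (F ≫ (p.fibreι X).f₀) ≫ p.f₀ = terminal.from _ ≫ X := by
  rw [Category.assoc, fibreι_f₀_comp, comp_terminal_from_assoc]

lemma comp_fibreι_comp_f₁ {T : E} (F : T ⟶ (p.fibre X).obj₁) :
    (F ≫ (p.fibreι X).f₁) ≫ p.f₁ = terminal.from _ ≫ X ≫ U.e := by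
  rw [Category.assoc, fibreι_f₁_comp, comp_terminal_from_assoc]

lemma IsFibrewiseAntisymm.fibre_eq (hp : p.IsFibrewiseAntisymm) {T : E}
    {F G : T ⟶ (p.fibre X).obj₀} (a b : T ⟶ P.obj₁)
    (has : a ≫ P.s = F ≫ (p.fibreι X).f₀) (hat : a ≫ P.t = G ≫ (p.fibreι X).f₀)
    (hbs : b ≫ P.s = G ≫ (p.fibreι X).f₀) (hbt : b ≫ P.t = F ≫ (p.fibreι X).f₀)
    (ha : a ≫ p.f₁ = terminal.from _ ≫ X ≫ U.e) (hb : b ≫ p.f₁ = terminal.from _ ≫ X ≫ U.e) :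
    F = G := by
  refine fibre_hom_ext₀ (has.symm.trans ((hp a b ?_ ?_ ?_ ?_).trans hat))
  · rw [has, hbt]
  · rw [hat, hbs]
  · rw [ha, has, Category.assoc, reassoc_of% comp_fibreι_comp_f₀ F]
  · rw [hb, hbs, Category.assoc, reassoc_of% comp_fibreι_comp_f₀ G]

/-- Two functors between fibres that are the domains of 2-cells above `f`, the first of them
cartesian, are related by a vertical 2-cell. -/
lemma exists_vertical_of_isCartesian {f : ⊤_ E ⟶ U.obj₁} (hs : f ≫ U.s = X)
    {F G : IntFunctor (p.fibre Y) (p.fibre X)}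
    {α : IntNatTrans (F.comp (p.fibreι X)) (p.fibreι Y)}
    {β : IntNatTrans (G.comp (p.fibreι X)) (p.fibreι Y)}
    (hα : α.IsCartesian p) (hαf : α.app ≫ p.f₁ = terminal.from _ ≫ f)
    (hβf : β.app ≫ p.f₁ = terminal.from _ ≫ f) :
    ∃ ζ : (p.fibre Y).obj₀ ⟶ P.obj₁, ζ ≫ P.s = G.f₀ ≫ (p.fibreι X).f₀ ∧
      ζ ≫ P.t = F.f₀ ≫ (p.fibreι X).f₀ ∧ ζ ≫ p.f₁ = terminal.from _ ≫ X ≫ U.e := by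
  -- The universal property is applied to `β` and the identity of `X`, without change of base.
  let x := IntFunctor.id (p.fibre Y)
  have hx : p.fibreι Y = x.comp (p.fibreι Y) :=
    IntFunctor.ext (Category.id_comp _).symm (Category.id_comp _).symm
  obtain ⟨ξ, hξ⟩ : ∃ ξ : IntNatTrans (G.comp (p.fibreι X)) (x.comp (p.fibreι Y)),
      ξ.app = β.app := by rw [← hx]; exact ⟨β, rfl⟩
  obtain ⟨ζ, ⟨hζ, -⟩, -⟩ := hα _ x _ ξ
    (constIdTrans X (comp_fibreι_comp_f₀ G.f₀)
      ((Category.assoc (𝟙 _) _ _).trans ((Category.id_comp _).trans (comp_fibreι_comp_f₀ F.f₀)))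
      (comp_fibreι_comp_f₁ G.f₁)
      ((Category.assoc (𝟙 _) _ _).trans ((Category.id_comp _).trans (comp_fibreι_comp_f₁ F.f₁))))
    (IntNatTrans.ext (by
      refine Eq.trans ?_ (mul_terminal_from_right hs _ ?_ rfl).symm
      · exact (congrArg (· ≫ p.f₁) hξ).trans hβf
      · exact (Category.assoc (𝟙 _) _ _).trans ((Category.id_comp _).trans hαf)))
  exact ⟨ζ.app, ζ.app_s, ζ.app_t.trans (Category.id_comp _), congrArg IntNatTrans.app hζ⟩

/-- Two functors between fibres that are the codomains of 2-cells above `f`, the first of them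
opcartesian, are related by a vertical 2-cell. -/
lemma exists_vertical_of_isOpcartesian {f : ⊤_ E ⟶ U.obj₁} (ht : f ≫ U.t = Y)
    {F G : IntFunctor (p.fibre X) (p.fibre Y)}
    {α : IntNatTrans (p.fibreι X) (F.comp (p.fibreι Y))}
    {β : IntNatTrans (p.fibreι X) (G.comp (p.fibreι Y))}
    (hα : α.IsOpcartesian p) (hαf : α.app ≫ p.f₁ = terminal.from _ ≫ f)
    (hβf : β.app ≫ p.f₁ = terminal.from _ ≫ f) :
    ∃ ζ : (p.fibre X).obj₀ ⟶ P.obj₁, ζ ≫ P.s = F.f₀ ≫ (p.fibreι Y).f₀ ∧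
      ζ ≫ P.t = G.f₀ ≫ (p.fibreι Y).f₀ ∧ ζ ≫ p.f₁ = terminal.from _ ≫ Y ≫ U.e := by
  -- The universal property is applied to `β` and the identity of `Y`, without change of base.
  let x := IntFunctor.id (p.fibre X)
  have hx : p.fibreι X = x.comp (p.fibreι X) :=
    IntFunctor.ext (Category.id_comp _).symm (Category.id_comp _).symm
  obtain ⟨ξ, hξ⟩ : ∃ ξ : IntNatTrans (x.comp (p.fibreι X)) (G.comp (p.fibreι Y)),
      ξ.app = β.app := by rw [← hx]; exact ⟨β, rfl⟩
  obtain ⟨ζ, ⟨hζ, -⟩, -⟩ := hα _ x _ ξ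
    (constIdTrans Y
      ((Category.assoc (𝟙 _) _ _).trans ((Category.id_comp _).trans (comp_fibreι_comp_f₀ F.f₀)))
      (comp_fibreι_comp_f₀ G.f₀)
      ((Category.assoc (𝟙 _) _ _).trans ((Category.id_comp _).trans (comp_fibreι_comp_f₁ F.f₁)))
      (comp_fibreι_comp_f₁ G.f₁))
    (IntNatTrans.ext (by
      refine Eq.trans ?_ (mul_terminal_from_left ht _ rfl ?_).symm
      · exact (congrArg (· ≫ p.f₁) hξ).trans hβf
      · exact (Category.assoc (𝟙 _) _ _).trans ((Category.id_comp _).trans hαf)))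
  exact ⟨ζ.app, ζ.app_s.trans (Category.id_comp _), ζ.app_t, congrArg IntNatTrans.app hζ⟩

/-- Reindexing between the fibres of an internal fibration with partially ordered fibres: `a` is
the cartesian lift of `f` to the generic object of the fibre over `Y`. -/
lemma existsUnique_reindex (hp : p.IsFaithful) (hp' : p.IsFibrewiseAntisymm)
    {f : ⊤_ E ⟶ U.obj₁} (hs : f ≫ U.s = X) (ht : f ≫ U.t = Y) (a : (p.fibre Y).obj₀ ⟶ P.obj₁)
    (hat : a ≫ P.t = (p.fibreι Y).f₀)
    (hap : a ≫ p.f₁ = terminal.from _ ≫ f) (ha : p.IsCartesianMor a) :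
    ∃! F : IntFunctor (p.fibre Y) (p.fibre X),
      ∃ α : IntNatTrans (F.comp (p.fibreι X)) (p.fibreι Y),
        α.IsCartesian p ∧ (α.whiskerRight p).app = terminal.from _ ≫ f := by
  have hap' {T : E} (x : T ⟶ (p.fibre Y).obj₀) : x ≫ a ≫ p.f₁ = terminal.from _ ≫ f := by
    rw [hap, comp_terminal_from_assoc]
  obtain ⟨f₀, hf₀⟩ := fibre_lift₀ (p := p) (X := X) (a ≫ P.s)
    (by rw [Category.assoc, ← p.comm_s, reassoc_of% hap, hs])
  -- The action on a morphism `b` of the fibre over `Y` lifts the identity of `X` along the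
  -- cartesian morphism at the target of `b`.
  obtain ⟨ζ, hζs, hζt, hζp⟩ := ha (p.fibre Y).t
    (P.mul (p.fibreι Y).f₁ ((p.fibre Y).s ≫ a)
      (by rw [Category.assoc, hat, (p.fibreι Y).comm_s]))
    (terminal.from _ ≫ X ≫ U.e)
    (by simp only [hap', Category.assoc, hs, U.e_t, Category.comp_id])
    (by rw [P.mul_t, hat, (p.fibreι Y).comm_t])
    (by
      rw [p.mul_comp, mul_terminal_from_right hs _ (hap' _) rfl,
        mul_terminal_from_left ht _ (fibreι_f₁_comp p Y)]
      rw [Category.assoc, hap'])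
  obtain ⟨f₁, hf₁⟩ := fibre_lift₁ (p := p) (X := X) ζ hζp
  let F : IntFunctor (p.fibre Y) (p.fibre X) := .ofThin (hp.fibre_isThin X) f₀ f₁
    (fibre_hom_ext₀ (by
      rw [Category.assoc, ← (p.fibreι X).comm_s, reassoc_of% hf₁, Category.assoc, hf₀, hζs,
        P.mul_s, Category.assoc]))
    (fibre_hom_ext₀ (by
      rw [Category.assoc, ← (p.fibreι X).comm_t, reassoc_of% hf₁, Category.assoc, hf₀, hζt]))
  subst hs ht
  let α : IntNatTrans (F.comp (p.fibreι _)) (p.fibreι _) :=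
    hp.natTrans (constTrans f (comp_fibreι_comp_f₀ F.f₀) (fibreι_f₀_comp p _)
      (comp_fibreι_comp_f₁ F.f₁) (fibreι_f₁_comp p _)) a hf₀.symm hat hap
  have hα : α.IsCartesian p := hp.isCartesian α ha
  refine ⟨F, ⟨α, hα, hap⟩, ?_⟩
  rintro G ⟨β, hβ, hβf⟩
  apply IntFunctor.ext_of_isThin (hp.fibre_isThin _)
  obtain ⟨b, hbs, hbt, hb⟩ := exists_vertical_of_isCartesian rfl hα hap hβf
  obtain ⟨c, hcs, hct, hc⟩ := exists_vertical_of_isCartesian (β := α) rfl hβ hβf hap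
  exact hp'.fibre_eq b c hbs hbt hcs hct hb hc

/-- Existential quantification between the fibres of an internal opfibration with partially ordered
fibres: `a` is the opcartesian lift of `f` to the generic object of the fibre over `X`. -/
lemma existsUnique_exist (hp : p.IsFaithful) (hp' : p.IsFibrewiseAntisymm)
    {f : ⊤_ E ⟶ U.obj₁} (hs : f ≫ U.s = X) (ht : f ≫ U.t = Y) (a : (p.fibre X).obj₀ ⟶ P.obj₁)
    (has : a ≫ P.s = (p.fibreι X).f₀)
    (hap : a ≫ p.f₁ = terminal.from _ ≫ f) (ha : p.IsOpcartesianMor a) :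
    ∃! F : IntFunctor (p.fibre X) (p.fibre Y),
      ∃ α : IntNatTrans (p.fibreι X) (F.comp (p.fibreι Y)),
        α.IsOpcartesian p ∧ (α.whiskerRight p).app = terminal.from _ ≫ f := by
  have hap' {T : E} (x : T ⟶ (p.fibre X).obj₀) : x ≫ a ≫ p.f₁ = terminal.from _ ≫ f := by
    rw [hap, comp_terminal_from_assoc]
  obtain ⟨f₀, hf₀⟩ := fibre_lift₀ (p := p) (X := Y) (a ≫ P.t)
    (by rw [Category.assoc, ← p.comm_t, reassoc_of% hap, ht])
  -- The action on a morphism `b` of the fibre over `X` lifts the identity of `Y` along the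
  -- opcartesian morphism at the source of `b`.
  obtain ⟨ζ, hζs, hζt, hζp⟩ := ha (p.fibre X).s
    (P.mul ((p.fibre X).t ≫ a) (p.fibreι X).f₁
      (by rw [Category.assoc, has, (p.fibreι X).comm_t]))
    (terminal.from _ ≫ Y ≫ U.e)
    (by simp only [hap', Category.assoc, ht, U.e_s, Category.comp_id])
    (by rw [P.mul_s, has, (p.fibreι X).comm_s])
    (by
      rw [p.mul_comp, mul_terminal_from_left ht _ rfl (hap' _),
        mul_terminal_from_right hs _ _ (fibreι_f₁_comp p X)]
      rw [Category.assoc, hap'])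
  obtain ⟨f₁, hf₁⟩ := fibre_lift₁ (p := p) (X := Y) ζ hζp
  let F : IntFunctor (p.fibre X) (p.fibre Y) := .ofThin (hp.fibre_isThin Y) f₀ f₁
    (fibre_hom_ext₀ (by
      rw [Category.assoc, ← (p.fibreι Y).comm_s, reassoc_of% hf₁, Category.assoc, hf₀, hζs]))
    (fibre_hom_ext₀ (by
      rw [Category.assoc, ← (p.fibreι Y).comm_t, reassoc_of% hf₁, Category.assoc, hf₀, hζt,
        P.mul_t, Category.assoc]))
  subst hs ht
  let α : IntNatTrans (p.fibreι _) (F.comp (p.fibreι _)) :=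
    hp.natTrans (constTrans f (fibreι_f₀_comp p _) (comp_fibreι_comp_f₀ F.f₀)
      (fibreι_f₁_comp p _) (comp_fibreι_comp_f₁ F.f₁)) a has hf₀.symm hap
  have hα : α.IsOpcartesian p := hp.isOpcartesian α ha
  refine ⟨F, ⟨α, hα, hap⟩, ?_⟩
  rintro G ⟨β, hβ, hβf⟩
  apply IntFunctor.ext_of_isThin (hp.fibre_isThin _)
  obtain ⟨b, hbs, hbt, hb⟩ := exists_vertical_of_isOpcartesian rfl hα hap hβf
  obtain ⟨c, hcs, hct, hc⟩ := exists_vertical_of_isOpcartesian (β := α) rfl hβ hβf hap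
  exact hp'.fibre_eq c b hcs hct hbs hbt hc hb

end Fibres

end IntFunctor

/-! ### Predicates on sheaves through their local truth -/

namespace SheafPred

section

variable {C : Type u} [SmallCategory C] {K : GrothendieckTopology C}

/-- The predicate `P` holds at `x` if its truth value there is the maximal sieve. -/
def Holds (P : SheafPred K) {A : C} (x : P.carrier.obj.obj (op A)) : Prop :=
  P.value x (𝟙 A)

lemma value_map (P : SheafPred K) {A B : C} (f : B ⟶ A) (x : P.carrier.obj.obj (op A)) :
    P.value (P.carrier.obj.map f.op x) = (P.value x).pullback f :=
  congrArg Subtype.val (natTrans_app_map P.char.hom f.op x)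

/-- Truth values are recovered from the elements at which the predicate holds. -/
lemma value_apply (P : SheafPred K) {A B : C} (f : B ⟶ A) (x : P.carrier.obj.obj (op A)) :
    P.value x f ↔ P.Holds (P.carrier.obj.map f.op x) := by
  rw [Holds, value_map, Sieve.pullback_apply, Category.id_comp]

lemma Holds.map {P : SheafPred K} {A B : C} {x : P.carrier.obj.obj (op A)} (h : P.Holds x)
    (f : B ⟶ A) : P.Holds (P.carrier.obj.map f.op x) := by
  rw [← value_apply, ← Category.comp_id f]
  exact (P.value x).downward_closed h f

/-- Truth is local, since truth values are closed sieves. -/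
lemma holds_of_mem (P : SheafPred K) {A : C} (x : P.carrier.obj.obj (op A)) {S : Sieve A}
    (hS : S ∈ K A)
    (h : ∀ ⦃B : C⦄ (f : B ⟶ A), S f → P.Holds (P.carrier.obj.map f.op x)) : P.Holds x := by
  have hc : K.IsClosed (P.value x) := (P.char.hom.app (op A) x).2
  refine hc (𝟙 A) ?_
  rw [K.covers_iff, Sieve.pullback_id]
  exact K.superset_covering (fun B f hf => (P.value_apply f x).2 (h f hf)) hS

/-- A morphism of sheaves is a morphism of predicates if it preserves local truth. -/
lemma entails_of_holds {P Q : SheafPred K} (γ : P.carrier ⟶ Q.carrier)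
    (h : ∀ (A : C) (x : P.carrier.obj.obj (op A)), P.Holds x → Q.Holds (γ.hom.app (op A) x))
    (A : C) (x : P.carrier.obj.obj (op A)) : P.value x ≤ Q.value (γ.hom.app (op A) x) := by
  intro B f hf
  rw [value_apply] at hf ⊢
  rw [← natTrans_app_map]
  exact h B _ hf

lemma Hom.holds {P Q : SheafPred K} (γ : SheafPred.Hom P Q) {A : C}
    {x : P.carrier.obj.obj (op A)} (h : P.Holds x) : Q.Holds (γ.hom.hom.app (op A) x) :=
  γ.entails A x _ h

lemma char_ext {F : Sheaf K (Type u)} {α β : F ⟶ sheafOmega K}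
    (h : ∀ (A : C) (x : F.obj.obj (op A)),
      (SheafPred.mk F α).Holds x ↔ (SheafPred.mk F β).Holds x) : α = β := by
  apply Sheaf.hom_ext
  ext A x
  refine Subtype.ext (Sieve.ext fun B f => ?_)
  exact ((SheafPred.mk F α).value_apply f x).trans
    ((h B _).trans ((SheafPred.mk F β).value_apply f x).symm)

/-- The sieve of those arrows along which the restriction of `x` satisfies `q`. -/
def predSieve {F : Cᵒᵖ ⥤ Type u} (q : ∀ A : C, F.obj (op A) → Prop)
    (hq : ∀ ⦃A B : C⦄ (f : B ⟶ A) (x : F.obj (op A)), q A x → q B (F.map f.op x)) {A : C}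
    (x : F.obj (op A)) : Sieve A where
  arrows B f := q B (F.map f.op x)
  downward_closed {B D} f hf g := by
    rw [op_comp, F.map_comp]
    exact hq g _ hf

/-- The characteristic morphism of the closure of a subpresheaf `q` of a sheaf. -/
def charOf (F : Sheaf K (Type u)) (q : ∀ A : C, F.obj.obj (op A) → Prop)
    (hq : ∀ ⦃A B : C⦄ (f : B ⟶ A) (x : F.obj.obj (op A)), q A x → q B (F.obj.map f.op x)) :
    F ⟶ sheafOmega K :=
  ⟨{ app := fun A => ↾fun x =>
      (⟨K.close (predSieve q hq (A := A.unop) x), K.close_isClosed _⟩ :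
        (Functor.closedSieves K).toFunctor.obj A)
     naturality := fun A B f => by
      ext x
      refine Subtype.ext (Eq.trans ?_ (K.pullback_close f.unop (predSieve q hq (A := A.unop) x)))
      refine congrArg (K.close) ?_
      ext D g
      change q D (F.obj.map g.op (F.obj.map f x)) ↔ q D (F.obj.map (g ≫ f.unop).op x)
      rw [op_comp, F.obj.map_comp]
      rfl }⟩

lemma holds_charOf (F : Sheaf K (Type u)) (q : ∀ A : C, F.obj.obj (op A) → Prop)
    (hq : ∀ ⦃A B : C⦄ (f : B ⟶ A) (x : F.obj.obj (op A)), q A x → q B (F.obj.map f.op x))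
    {A : C} (x : F.obj.obj (op A)) :
    (SheafPred.mk F (charOf F q hq)).Holds x ↔ predSieve q hq x ∈ K A := by
  change K.Covers (predSieve q hq x) (𝟙 A) ↔ _
  rw [K.covers_iff, Sieve.pullback_id]

/-- The direct image of a predicate `α` along `γ`: it holds at `y` if, locally, `y` is the image
of an element at which `α` holds. -/
def image {F G : Sheaf K (Type u)} (γ : F ⟶ G) (α : F ⟶ sheafOmega K) : G ⟶ sheafOmega K :=
  charOf G (fun A y => ∃ x : F.obj.obj (op A), (SheafPred.mk F α).Holds x ∧
    γ.hom.app (op A) x = y) (by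
      rintro A B f _ ⟨x, hx, rfl⟩
      exact ⟨F.obj.map f.op x, hx.map f, natTrans_app_map _ _ _⟩)

end

section Restriction

variable {C C' : Type u} [SmallCategory C] [SmallCategory C'] {K : GrothendieckTopology C}
  {K' : GrothendieckTopology C'} (H : C ⥤ C') [H.IsContinuous K K']
  (hH : CoverPreserving K K' H)

lemma holds_restrict (P : SheafPred K') {A : C} (x : P.carrier.obj.obj (op (H.obj A))) :
    ((restrict H hH).obj P).Holds (A := A) x ↔ P.Holds x := by
  change P.value x (H.map (𝟙 A)) ↔ _
  rw [H.map_id]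
  rfl

/-- Restriction of the characteristic morphism of a predicate. -/
abbrev restrictChar {F : Sheaf K' (Type u)} (α : F ⟶ sheafOmega K') :
    (H.sheafPushforwardContinuous (Type u) K K').obj F ⟶ sheafOmega K :=
  (H.sheafPushforwardContinuous (Type u) K K').map α ≫ omegaRestrict H hH

/-- Direct images commute with restriction along functors that detect and preserve covering
sieves (the Beck–Chevalley condition). -/
lemma restrictChar_image (hH' : ∀ (A : C) (S : Sieve (H.obj A)),
      S.functorPullback H ∈ K A ↔ S ∈ K' (H.obj A))
    {F G : Sheaf K' (Type u)} (γ : F ⟶ G) (α : F ⟶ sheafOmega K') :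
    restrictChar H hH (image γ α) =
      image ((H.sheafPushforwardContinuous (Type u) K K').map γ) (restrictChar H hH α) := by
  apply char_ext
  intro A y
  refine (holds_restrict H hH ⟨G, image γ α⟩ y).trans ?_
  refine (holds_charOf _ _ _ _).trans (Iff.trans ?_ (holds_charOf _ _ _ _).symm)
  refine (hH' A _).symm.trans (iff_of_eq (congrArg (· ∈ K A) ?_))
  ext B f
  refine exists_congr fun x => and_congr ?_ Iff.rfl
  exact (holds_restrict H hH ⟨F, α⟩ x).symm

end Restriction

/-! ### Inverse and direct images as cartesian and opcartesian lifts -/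

section Lifts

variable {C : Type u} [SmallCategory C] {K : GrothendieckTopology C}

/-- The inverse image of a predicate on the target of a morphism of sheaves. The morphism is an
object of the arrow category, as in `Univ₁`, so that the target is equal to the carrier of the
predicate by a hypothesis only. -/
def inverseImage (φ : Arrow (Sheaf K (Type u))) (P : SheafPred K) (h : P.carrier = φ.right) :
    SheafPred K :=
  ⟨φ.left, φ.hom ≫ eqToHom h.symm ≫ P.char⟩

/-- The direct image of a predicate on the source of a morphism of sheaves. -/
def directImage (φ : Arrow (Sheaf K (Type u))) (P : SheafPred K) (h : P.carrier = φ.left) :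
    SheafPred K :=
  ⟨φ.right, image φ.hom (eqToHom h.symm ≫ P.char)⟩

/-- The lift of `φ` from the inverse image; it is cartesian by `exists_hom_inverseImage`. -/
lemma exists_inverseImage_hom (φ : Arrow (Sheaf K (Type u))) (P : SheafPred K)
    (h : P.carrier = φ.right) :
    ∃ a : Arrow (SheafPred K), a.left = inverseImage φ P h ∧ a.right = P ∧
      (forget K).mapArrow.obj a = φ := by
  obtain ⟨F, G, γ⟩ := φ
  obtain ⟨G', α⟩ := P
  obtain rfl : G' = G := h
  -- The identities in this proof and those below are what `eqToHom` reduces to.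
  let P' : SheafPred K := ⟨F, γ ≫ 𝟙 _ ≫ α⟩
  let Q : SheafPred K := ⟨G', α⟩
  let k : P' ⟶ Q := ⟨γ, entails_of_holds (P := P') (Q := Q) γ fun A x hx => hx⟩
  exact ⟨Arrow.mk k, rfl, rfl, rfl⟩

/-- The lift of `φ` to the direct image; it is opcartesian by `exists_directImage_hom_of_hom`. -/
lemma exists_directImage_hom (φ : Arrow (Sheaf K (Type u))) (P : SheafPred K)
    (h : P.carrier = φ.left) :
    ∃ a : Arrow (SheafPred K), a.left = P ∧ a.right = directImage φ P h ∧
      (forget K).mapArrow.obj a = φ := by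
  obtain ⟨F, G, γ⟩ := φ
  obtain ⟨F', α⟩ := P
  obtain rfl : F' = F := h
  let P : SheafPred K := ⟨F', α⟩
  let Q : SheafPred K := ⟨G, image γ (𝟙 _ ≫ α)⟩
  let k : P ⟶ Q := ⟨γ, entails_of_holds (P := P) (Q := Q) γ fun A x hx => by
    refine (holds_charOf _ _ _ _).2 (K.superset_covering ?_ (K.top_mem A))
    intro B f _
    exact ⟨F'.obj.map f.op x, (Category.id_comp α).symm ▸ hx.map f, natTrans_app_map _ _ _⟩⟩
  exact ⟨Arrow.mk k, rfl, rfl, rfl⟩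

/-- The inverse image is universal: a morphism to `P` above `φ ∘ γ` gives one to the inverse image
of `P` above `γ`. -/
lemma exists_hom_inverseImage (φ : Arrow (Sheaf K (Type u))) (P : SheafPred K)
    (h : P.carrier = φ.right) (ξ : Arrow (SheafPred K)) (γ : Arrow (Sheaf K (Type u)))
    (hγ : φ.left = γ.right) (hξ : ξ.right = P)
    (hξγ : (forget K).mapArrow.obj ξ = arrowComp φ γ hγ) :
    ∃ ζ : Arrow (SheafPred K), ζ.left = ξ.left ∧ ζ.right = inverseImage φ P h ∧
      (forget K).mapArrow.obj ζ = γ := by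
  obtain ⟨F, G, φ⟩ := φ
  obtain ⟨R, F', γ⟩ := γ
  obtain rfl : F = F' := hγ
  obtain ⟨G', α⟩ := P
  obtain rfl : G' = G := h
  obtain ⟨⟨R', ρ⟩, Q, ξ⟩ := ξ
  obtain rfl : Q = ⟨G', α⟩ := hξ
  obtain rfl : R' = R := congrArg Comma.left hξγ
  have e : ξ.hom = γ ≫ φ := by
    refine (Arrow.mk_injective _ _ hξγ).trans ?_
    change γ ≫ 𝟙 _ ≫ φ = _
    rw [Category.id_comp]
  let P : SheafPred K := ⟨R', ρ⟩
  let Q : SheafPred K := ⟨F, φ ≫ 𝟙 _ ≫ α⟩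
  let k : P ⟶ Q := ⟨γ, entails_of_holds (P := P) (Q := Q) γ fun A x hx => by
    have := ξ.holds hx
    rw [e] at this
    exact this⟩
  exact ⟨Arrow.mk k, rfl, rfl, rfl⟩

/-- The direct image is universal: a morphism from `P` above `γ ∘ φ` gives one from the direct
image of `P` above `γ`, since the target predicate is local. -/
lemma exists_directImage_hom_of_hom (φ : Arrow (Sheaf K (Type u))) (P : SheafPred K)
    (h : P.carrier = φ.left) (ξ : Arrow (SheafPred K)) (γ : Arrow (Sheaf K (Type u)))
    (hγ : γ.left = φ.right) (hξ : ξ.left = P)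
    (hξγ : (forget K).mapArrow.obj ξ = arrowComp γ φ hγ) :
    ∃ ζ : Arrow (SheafPred K), ζ.left = directImage φ P h ∧ ζ.right = ξ.right ∧
      (forget K).mapArrow.obj ζ = γ := by
  obtain ⟨F, G, φ⟩ := φ
  obtain ⟨G', R, γ⟩ := γ
  obtain rfl : G' = G := hγ
  obtain ⟨F', α⟩ := P
  obtain rfl : F' = F := h
  obtain ⟨Q, ⟨R', ρ⟩, ξ⟩ := ξ
  obtain rfl : Q = ⟨F', α⟩ := hξ
  obtain rfl : R' = R := congrArg Comma.right hξγ
  have e : ξ.hom = φ ≫ γ := by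
    refine (Arrow.mk_injective _ _ hξγ).trans ?_
    change φ ≫ 𝟙 _ ≫ γ = _
    rw [Category.id_comp]
  let P : SheafPred K := ⟨G', image φ (𝟙 _ ≫ α)⟩
  let Q : SheafPred K := ⟨R', ρ⟩
  let k : P ⟶ Q := ⟨γ, entails_of_holds (P := P) (Q := Q) γ fun A y hy => by
    refine Q.holds_of_mem _ ((holds_charOf _ _ _ _).1 hy) ?_
    rintro B f ⟨x, hx, hxy⟩
    rw [Category.id_comp] at hx
    have := ξ.holds hx
    rw [e] at this
    refine Eq.mp (congrArg Q.Holds ?_) this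
    exact (congrArg (γ.hom.app (op B)) hxy).trans (natTrans_app_map _ _ _)⟩
  exact ⟨Arrow.mk k, rfl, rfl, rfl⟩

variable {C' : Type u} [SmallCategory C'] {K' : GrothendieckTopology C'} (H : C ⥤ C')
  [H.IsContinuous K K'] (hH : CoverPreserving K K' H)

lemma restrict_inverseImage (φ : Arrow (Sheaf K' (Type u))) (P : SheafPred K')
    (h : P.carrier = φ.right) (h' : ((restrict H hH).obj P).carrier =
      ((H.sheafPushforwardContinuous (Type u) K K').mapArrow.obj φ).right) :
    (restrict H hH).obj (inverseImage φ P h) =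
      inverseImage ((H.sheafPushforwardContinuous (Type u) K K').mapArrow.obj φ)
        ((restrict H hH).obj P) h' := by
  obtain ⟨F, G, γ⟩ := φ
  obtain ⟨G', α⟩ := P
  obtain rfl : G' = G := h
  rfl

lemma restrict_directImage (hH' : ∀ (A : C) (S : Sieve (H.obj A)),
      S.functorPullback H ∈ K A ↔ S ∈ K' (H.obj A))
    (φ : Arrow (Sheaf K' (Type u))) (P : SheafPred K')
    (h : P.carrier = φ.left) (h' : ((restrict H hH).obj P).carrier =
      ((H.sheafPushforwardContinuous (Type u) K K').mapArrow.obj φ).left) :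
    (restrict H hH).obj (directImage φ P h) =
      directImage ((H.sheafPushforwardContinuous (Type u) K K').mapArrow.obj φ)
        ((restrict H hH).obj P) h' := by
  obtain ⟨F, G, γ⟩ := φ
  obtain ⟨F', α⟩ := P
  obtain rfl : F' = F := h
  exact congrArg (SheafPred.mk _) (restrictChar_image H hH hH' γ (𝟙 _ ≫ α))

end Lifts

end SheafPred

/-! ### The projection from predicates to sheaves as an internal functor -/

section Arrows

namespace SheafPred

variable {C : Type u} [SmallCategory C] {K : GrothendieckTopology C}

/-- Entailment is a property, so a morphism of predicates with given source and target is
determined by the underlying morphism of sheaves. -/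
lemma arrow_ext {a b : Arrow (SheafPred K)} (hl : a.left = b.left) (hr : a.right = b.right)
    (h : (forget K).mapArrow.obj a = (forget K).mapArrow.obj b) : a = b := by
  obtain ⟨P, Q, f⟩ := a
  obtain ⟨P', Q', g⟩ := b
  obtain rfl : P = P' := hl
  obtain rfl : Q = Q' := hr
  exact congrArg Arrow.mk (SheafPred.Hom.ext (Arrow.mk_injective _ _ h))

/-- The predicates on a fixed sheaf are partially ordered by entailment. -/
lemma eq_of_vertical (a b : Arrow (SheafPred K)) (h₁ : a.left = b.right) (h₂ : a.right = b.left)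
    (ha : (forget K).mapArrow.obj a = Arrow.mk (𝟙 a.left.carrier))
    (hb : (forget K).mapArrow.obj b = Arrow.mk (𝟙 b.left.carrier)) : a.left = a.right := by
  obtain ⟨⟨F, α⟩, ⟨G, β⟩, f⟩ := a
  obtain ⟨Q, P, g⟩ := b
  obtain rfl : ⟨F, α⟩ = P := h₁
  obtain rfl : ⟨G, β⟩ = Q := h₂
  obtain rfl : G = F := congrArg Comma.right ha
  have hf : f.hom = 𝟙 _ := Arrow.mk_injective _ _ ha
  have hg : g.hom = 𝟙 _ := Arrow.mk_injective _ _ hb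
  refine congrArg (SheafPred.mk _) (char_ext fun A x => ⟨fun hx => ?_, fun hx => ?_⟩)
  · have := f.holds hx
    rwa [hf] at this
  · have := g.holds hx
    rwa [hg] at this

lemma inverseImage_congr {φ φ' : Arrow (Sheaf K (Type u))} {P P' : SheafPred K} (hφ : φ = φ')
    (hP : P = P') (h : P.carrier = φ.right) :
    inverseImage φ P h = inverseImage φ' P' (by rw [← hφ, ← hP, h]) := by
  subst hφ hP; rfl

lemma directImage_congr {φ φ' : Arrow (Sheaf K (Type u))} {P P' : SheafPred K} (hφ : φ = φ')
    (hP : P = P') (h : P.carrier = φ.left) :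
    directImage φ P h = directImage φ' P' (by rw [← hφ, ← hP, h]) := by
  subst hφ hP; rfl

end SheafPred

/-- Both sides say that the sieve of underlying arrows of `C` covers the domain of `Z`. -/
lemma functorPullback_overMap_mem_iff {C : Type u} [SmallCategory C] (J : GrothendieckTopology C)
    {A B : C} (f : B ⟶ A) (Z : Over B) (S : Sieve ((Over.map f).obj Z)) :
    S.functorPullback (Over.map f) ∈ J.over B Z ↔ S ∈ J.over A ((Over.map f).obj Z) := by
  rw [J.mem_over_iff, J.mem_over_iff, Sieve.overEquiv_functorPullback_map]
  rfl

end Arrows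

section Pred

variable {C : Type u} [SmallCategory C] (J : GrothendieckTopology C)

lemma predFunctor_isFaithful : (predFunctor J).IsFaithful := by
  intro T a b hs ht h
  ext A w
  exact SheafPred.arrow_ext (K := J.over A.unop)
    (congrArg (fun k : T ⟶ (Pred J).obj₀ => k.app A w) hs)
    (congrArg (fun k : T ⟶ (Pred J).obj₀ => k.app A w) ht)
    (congrArg (fun k : T ⟶ (Univ J).obj₁ => k.app A w) h)

lemma predFunctor_isFibrewiseAntisymm : (predFunctor J).IsFibrewiseAntisymm := by
  intro T a b h₁ h₂ ha hb
  ext A w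
  exact SheafPred.eq_of_vertical (K := J.over A.unop) (a.app A w) (b.app A w)
    (congrArg (fun k : T ⟶ (Pred J).obj₀ => k.app A w) h₁)
    (congrArg (fun k : T ⟶ (Pred J).obj₀ => k.app A w) h₂)
    (congrArg (fun k : T ⟶ (Univ J).obj₁ => k.app A w) ha)
    (congrArg (fun k : T ⟶ (Univ J).obj₁ => k.app A w) hb)

variable {J} {T : Cᵒᵖ ⥤ Type (u + 1)}

/-- Generalised morphisms of predicates may be given stage by stage, since they are determined by
their sources, targets and underlying morphisms of sheaves. -/
lemma exists_predMor (l r : T ⟶ (Pred J).obj₀) (γ : T ⟶ (Univ J).obj₁)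
    (h : ∀ (A : Cᵒᵖ) (w : T.obj A), ∃ ζ : Arrow (SheafPred (J.over A.unop)),
      ζ.left = l.app A w ∧ ζ.right = r.app A w ∧
        (SheafPred.forget (J.over A.unop)).mapArrow.obj ζ = γ.app A w) :
    ∃ ζ : T ⟶ (Pred J).obj₁,
      ζ ≫ (Pred J).s = l ∧ ζ ≫ (Pred J).t = r ∧ ζ ≫ (predFunctor J).f₁ = γ := by
  choose z hl hr hz using h
  refine ⟨{ app := fun A => ↾fun w => (z A w : (Pred J).obj₁.obj A), naturality := ?_ },
    ?_, ?_, ?_⟩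
  · intro A B k
    ext w
    refine SheafPred.arrow_ext (K := J.over B.unop) ?_ ?_ ?_
    · refine (hl B _).trans ((natTrans_app_map l k w).trans ?_)
      exact congrArg ((Pred J).obj₀.map k) (hl A w).symm
    · refine (hr B _).trans ((natTrans_app_map r k w).trans ?_)
      exact congrArg ((Pred J).obj₀.map k) (hr A w).symm
    · refine (hz B _).trans ((natTrans_app_map γ k w).trans ?_)
      exact congrArg ((Univ J).obj₁.map k) (hz A w).symm
  · ext A w
    exact hl A w
  · ext A w
    exact hr A w
  · ext A w
    exact hz A w

lemma univ_mul_app (g f : T ⟶ (Univ J).obj₁) (h : g ≫ (Univ J).s = f ≫ (Univ J).t) (A : Cᵒᵖ)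
    (w : T.obj A) : ((Univ J).mul g f h).app A w =
      arrowComp (D := Sheaf (J.over A.unop) (Type u)) (g.app A w) (f.app A w)
        (congrArg (fun k : T ⟶ (Univ J).obj₀ => k.app A w) h) :=
  lift_arrowPresheafComp (univPresheaf J) g f h A w

/-- The internal fibration property: `φ` has a cartesian lift with target `y`, formed by inverse
images. -/
lemma exists_cartesian_lift (y : T ⟶ (Pred J).obj₀) (φ : T ⟶ (Univ J).obj₁)
    (h : y ≫ (predFunctor J).f₀ = φ ≫ (Univ J).t) :
    ∃ a : T ⟶ (Pred J).obj₁, a ≫ (Pred J).t = y ∧ a ≫ (predFunctor J).f₁ = φ ∧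
      (predFunctor J).IsCartesianMor a := by
  have hw (A : Cᵒᵖ) (w : T.obj A) := congrArg (fun k : T ⟶ (Univ J).obj₀ => k.app A w) h
  let l : T ⟶ (Pred J).obj₀ :=
    { app := fun A => ↾fun w => (SheafPred.inverseImage (K := J.over A.unop)
        (φ.app A w) (y.app A w) (hw A w) : (Pred J).obj₀.obj A)
      naturality := fun A B k => by
        ext w
        exact (SheafPred.inverseImage_congr (K := J.over B.unop) (natTrans_app_map φ k w)
          (natTrans_app_map y k w) (hw B _)).trans
          (SheafPred.restrict_inverseImage (Over.map k.unop) (J.over_map_coverPreserving k.unop)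
            (φ.app A w) (y.app A w) (hw A w) _).symm }
  obtain ⟨a, ha, hat, hap⟩ := exists_predMor l y φ fun A w =>
    SheafPred.exists_inverseImage_hom (K := J.over A.unop) _ _ (hw A w)
  refine ⟨a, hat, hap, ?_⟩
  intro T' x ξ γ h₁ h₂ h₃
  rw [hat] at h₂
  simp only [hap] at h₁ h₃
  rw [ha]
  refine exists_predMor (ξ ≫ (Pred J).s) (x ≫ l) γ fun A w => ?_
  refine SheafPred.exists_hom_inverseImage (K := J.over A.unop) _ _ (hw A (x.app A w))
    (ξ.app A w) (γ.app A w) (congrArg (fun k : T' ⟶ (Univ J).obj₀ => k.app A w) h₁)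
    (congrArg (fun k : T' ⟶ (Pred J).obj₀ => k.app A w) h₂) ?_
  exact (congrArg (fun k : T' ⟶ (Univ J).obj₁ => k.app A w) h₃).trans
    (univ_mul_app (x ≫ φ) γ h₁ A w)

/-- The internal opfibration property: `φ` has an opcartesian lift with source `y`, formed by direct
images. -/
lemma exists_opcartesian_lift (y : T ⟶ (Pred J).obj₀) (φ : T ⟶ (Univ J).obj₁)
    (h : y ≫ (predFunctor J).f₀ = φ ≫ (Univ J).s) :
    ∃ a : T ⟶ (Pred J).obj₁, a ≫ (Pred J).s = y ∧ a ≫ (predFunctor J).f₁ = φ ∧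
      (predFunctor J).IsOpcartesianMor a := by
  have hw (A : Cᵒᵖ) (w : T.obj A) := congrArg (fun k : T ⟶ (Univ J).obj₀ => k.app A w) h
  let r : T ⟶ (Pred J).obj₀ :=
    { app := fun A => ↾fun w => (SheafPred.directImage (K := J.over A.unop)
        (φ.app A w) (y.app A w) (hw A w) : (Pred J).obj₀.obj A)
      naturality := fun A B k => by
        ext w
        exact (SheafPred.directImage_congr (K := J.over B.unop) (natTrans_app_map φ k w)
          (natTrans_app_map y k w) (hw B _)).trans
          (SheafPred.restrict_directImage (Over.map k.unop) (J.over_map_coverPreserving k.unop)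
            (functorPullback_overMap_mem_iff J k.unop)
            (φ.app A w) (y.app A w) (hw A w) _).symm }
  obtain ⟨a, has, ha, hap⟩ := exists_predMor y r φ fun A w =>
    SheafPred.exists_directImage_hom (K := J.over A.unop) _ _ (hw A w)
  refine ⟨a, has, hap, ?_⟩
  intro T' x ξ γ h₁ h₂ h₃
  rw [has] at h₂
  simp only [hap] at h₁ h₃
  rw [ha]
  refine exists_predMor (x ≫ r) (ξ ≫ (Pred J).t) γ fun A w => ?_
  refine SheafPred.exists_directImage_hom_of_hom (K := J.over A.unop) _ _ (hw A (x.app A w))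
    (ξ.app A w) (γ.app A w) (congrArg (fun k : T' ⟶ (Univ J).obj₀ => k.app A w) h₁)
    (congrArg (fun k : T' ⟶ (Pred J).obj₀ => k.app A w) h₂) ?_
  exact (congrArg (fun k : T' ⟶ (Univ J).obj₁ => k.app A w) h₃).trans
    (univ_mul_app γ (x ≫ φ) h₁ A w)

end Pred

/-! ### Gluing predicates on slices -/

namespace SheafPred

section Holds

variable {C : Type u} [SmallCategory C] {K : GrothendieckTopology C}

/-- Heterogeneous equality allows the comparison of elements of sheaves that are only
propositionally equal, such as the restrictions of a sheaf along `m ≫ k` and along `k` and `m`. -/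
lemma holds_iff_of_heq {P Q : SheafPred K} (h : P = Q) {A : C} {x : P.carrier.obj.obj (op A)}
    {y : Q.carrier.obj.obj (op A)} (hxy : x ≍ y) : P.Holds x ↔ Q.Holds y := by
  subst h
  rw [eq_of_heq hxy]

lemma holds_map_iff_of_isIso (P : SheafPred K) {A B : C} (f : B ⟶ A) [IsIso f]
    (x : P.carrier.obj.obj (op A)) : P.Holds (P.carrier.obj.map f.op x) ↔ P.Holds x := by
  refine ⟨fun h => ?_, fun h => h.map f⟩
  have := h.map (inv f)
  rwa [← Functor.map_comp_apply, ← op_comp, IsIso.inv_hom_id, op_id,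
    Functor.map_id_apply] at this

lemma map_eqToHom_heq (F : Cᵒᵖ ⥤ Type u) {A B : C} (h : B = A) (x : F.obj (op A)) :
    F.map (eqToHom h).op x ≍ x := by
  subst h
  simp

end Holds

section Glue

variable {C : Type u} [SmallCategory C] {J : GrothendieckTopology C} {A : C}

/-- Restriction of predicates on the slice over `A` along `k : B → A`. -/
abbrev overRestrict (J : GrothendieckTopology C) {A B : C} (k : B ⟶ A) :
    SheafPred (J.over A) ⥤ SheafPred (J.over B) :=
  restrict (Over.map k) (J.over_map_coverPreserving k)

/-- Restriction of sheaves on the slice over `A` along `k : B → A`. -/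
abbrev sheafRestrict (J : GrothendieckTopology C) {A B : C} (k : B ⟶ A) :
    Sheaf (J.over A) (Type u) ⥤ Sheaf (J.over B) (Type u) :=
  (Over.map k).sheafPushforwardContinuous (Type u) (J.over B) (J.over A)

/-- Any object `Z` of the slice over `A` is the image of the terminal object `𝟙` of the slice over
the domain of `Z` under composition with the structure morphism of `Z`. -/
def overMapMkId (Z : Over A) : (Over.map Z.hom).obj (Over.mk (𝟙 Z.left)) ≅ Z :=
  Over.isoMk (Iso.refl _)

/-- A predicate on the slice over `A` holds at `x` if it holds at all restrictions of `x` to the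
slices over the domains of a sieve covering `A`. -/
lemma holds_of_local (P : SheafPred (J.over A)) {S : Sieve A} (hS : S ∈ J A) {Z : Over A}
    (x : P.carrier.obj.obj (op Z))
    (h : ∀ ⦃B : C⦄ (k : B ⟶ A) (_ : S k) (W : Over B) (m : (Over.map k).obj W ⟶ Z),
      P.Holds (P.carrier.obj.map m.op x)) : P.Holds x := by
  refine P.holds_of_mem x
    (J.overEquiv_symm_mem_over Z (S.pullback Z.hom) (J.pullback_stable Z.hom hS)) ?_
  intro W f hf
  have hf' : S (f.left ≫ Z.hom) := (Sieve.overEquiv_symm_iff _ _).1 hf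
  rw [Over.w] at hf'
  have := h W.hom hf' (Over.mk (𝟙 _)) ((overMapMkId W).hom ≫ f)
  rw [op_comp, Functor.map_comp_apply] at this
  exact (P.holds_map_iff_of_isIso (overMapMkId W).hom _).1 this

/-- Predicates on the same sheaf that agree on a covering sieve are equal. -/
lemma eq_of_local {P Q : SheafPred (J.over A)} (e : P.carrier = Q.carrier) {S : Sieve A}
    (hS : S ∈ J A)
    (h : ∀ ⦃B : C⦄ (k : B ⟶ A), S k → (overRestrict J k).obj P = (overRestrict J k).obj Q) :
    P = Q := by
  obtain ⟨F, α⟩ := P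
  obtain ⟨G, β⟩ := Q
  obtain rfl : F = G := e
  refine congrArg _ (char_ext fun Z x => ⟨fun hx => ?_, fun hx => ?_⟩)
  · refine holds_of_local _ hS _ fun B k hk W m => ?_
    refine (holds_restrict (Over.map k) (J.over_map_coverPreserving k) ⟨F, β⟩ _).1 ?_
    refine (holds_iff_of_heq (h k hk) HEq.rfl).1 ?_
    exact (holds_restrict (Over.map k) (J.over_map_coverPreserving k) ⟨F, α⟩ _).2 (hx.map m)
  · refine holds_of_local _ hS _ fun B k hk W m => ?_
    refine (holds_restrict (Over.map k) (J.over_map_coverPreserving k) ⟨F, α⟩ _).1 ?_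
    refine (holds_iff_of_heq (h k hk) HEq.rfl).2 ?_
    exact (holds_restrict (Over.map k) (J.over_map_coverPreserving k) ⟨F, β⟩ _).2 (hx.map m)

/-- Vertical morphisms of predicates, being inequalities, exist if they exist locally. -/
lemma exists_vertical_of_local {P Q : SheafPred (J.over A)} {F : Sheaf (J.over A) (Type u)}
    (hP : P.carrier = F) (hQ : Q.carrier = F) {S : Sieve A} (hS : S ∈ J A)
    (h : ∀ ⦃B : C⦄ (k : B ⟶ A), S k → ∃ a : Arrow (SheafPred (J.over B)),
      a.left = (overRestrict J k).obj P ∧ a.right = (overRestrict J k).obj Q ∧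
        (forget _).mapArrow.obj a = Arrow.mk (𝟙 ((sheafRestrict J k).obj F))) :
    ∃ a : Arrow (SheafPred (J.over A)), a.left = P ∧ a.right = Q ∧
      (forget _).mapArrow.obj a = Arrow.mk (𝟙 F) := by
  obtain ⟨G, β⟩ := Q
  obtain rfl : G = F := hQ
  obtain ⟨F, α⟩ := P
  obtain rfl : F = G := hP
  let P : SheafPred (J.over A) := ⟨F, α⟩
  let Q : SheafPred (J.over A) := ⟨F, β⟩
  let f : P ⟶ Q := ⟨𝟙 F, entails_of_holds (P := P) (Q := Q) (𝟙 F) fun Z x hx => by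
    refine holds_of_local Q hS _ fun B k hk W m => ?_
    obtain ⟨⟨P', Q', a⟩, hl, hr, ha⟩ := h k hk
    obtain rfl : P' = _ := hl
    obtain rfl : Q' = _ := hr
    have ha : a.hom = 𝟙 _ := Arrow.mk_injective _ _ ha
    refine (holds_restrict (Over.map k) (J.over_map_coverPreserving k) Q _).1 ?_
    have := a.holds
      ((holds_restrict (Over.map k) (J.over_map_coverPreserving k) P _).2 (hx.map m))
    rw [ha] at this
    exact this⟩
  exact ⟨Arrow.mk f, rfl, rfl, rfl⟩

section Amalgamation

variable {S : Sieve A} {F : Sheaf (J.over A) (Type u)}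
  {α : ∀ ⦃B : C⦄ (k : B ⟶ A), S k → ((sheafRestrict J k).obj F ⟶ sheafOmega (J.over B))}

/-- Compatibility of a family of predicates on the restrictions of `F`. -/
def IsCompatible (α : ∀ ⦃B : C⦄ (k : B ⟶ A), S k →
    ((sheafRestrict J k).obj F ⟶ sheafOmega (J.over B))) : Prop :=
  ∀ ⦃B D : C⦄ (k : B ⟶ A) (hk : S k) (m : D ⟶ B),
    (overRestrict J m).obj ⟨_, α k hk⟩ = ⟨_, α (m ≫ k) (S.downward_closed hk m)⟩

/-- The union of a family of predicates on the restrictions of `F`, as a predicate on the elements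
of `F` over the objects of a sieve: over `Z`, it is the member of the family at the structure
morphism of `Z`. -/
def GlueHolds (α : ∀ ⦃B : C⦄ (k : B ⟶ A), S k →
    ((sheafRestrict J k).obj F ⟶ sheafOmega (J.over B))) (Z : Over A) (x : F.obj.obj (op Z)) :
    Prop :=
  ∃ h : S Z.hom, (SheafPred.mk _ (α Z.hom h)).Holds (A := Over.mk (𝟙 Z.left))
    (F.obj.map (overMapMkId Z).hom.op x)

/-- The glued predicate restricts to the members of the family, also at those objects `W` of the
slice over `B` that are not terminal: compatibility along the structure morphism of `W` reduces
them to the terminal object of the slice over the domain of `W`. -/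
lemma glueHolds_iff (hα : IsCompatible α) {B : C} (k : B ⟶ A) (hk : S k) (W : Over B)
    (x : F.obj.obj (op ((Over.map k).obj W))) :
    GlueHolds α ((Over.map k).obj W) x ↔ (SheafPred.mk _ (α k hk)).Holds (A := W) x := by
  have hS : S ((Over.map k).obj W).hom := S.downward_closed hk W.hom
  have p : (Over.map k).obj ((Over.map W.hom).obj (Over.mk (𝟙 W.left))) =
      (Over.map (W.hom ≫ k)).obj (Over.mk (𝟙 W.left)) :=
    (Functor.congr_obj (Over.mapComp_eq W.hom k) _).symm
  have hp : eqToHom p ≫ (overMapMkId ((Over.map k).obj W)).hom =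
      (Over.map k).map (overMapMkId W).hom := by
    ext
    simp [overMapMkId]
  refine Iff.trans ?_
    (holds_map_iff_of_isIso (SheafPred.mk _ (α k hk)) (overMapMkId W).hom x)
  refine (exists_prop_of_true hS).trans ?_
  refine (holds_iff_of_heq (hα k hk W.hom) ?_).symm.trans
    (holds_restrict (Over.map W.hom) (J.over_map_coverPreserving W.hom) ⟨_, α k hk⟩ _)
  change F.obj.map ((Over.map k).map (overMapMkId W).hom).op x ≍ _
  rw [← hp, op_comp, Functor.map_comp_apply]
  exact map_eqToHom_heq F.obj p _

lemma GlueHolds.map (hα : IsCompatible α) {Z W : Over A} (f : W ⟶ Z) (x : F.obj.obj (op Z))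
    (hx : GlueHolds α Z x) : GlueHolds α W (F.obj.map f.op x) := by
  -- Up to equality, `W` comes from the slice over the domain of `Z`, where it is given by `g`.
  obtain ⟨W, k, rfl⟩ := W.mk_surjective
  obtain ⟨g : W ⟶ Z.left, rfl : g ≫ Z.hom = k, rfl⟩ := Over.homMk_surjective f
  obtain ⟨hS, hx⟩ := hx
  refine (glueHolds_iff hα Z.hom hS (Over.mk g) _).2 ?_
  have := hx.map (Over.homMk g : Over.mk g ⟶ Over.mk (𝟙 Z.left))
  refine Eq.mp (congrArg _ ?_) this
  change F.obj.map ((Over.map Z.hom).map _).op _ = _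
  rw [← Functor.map_comp_apply, ← op_comp]
  refine congrArg (fun h => F.obj.map (Quiver.Hom.op h) x) ?_
  ext
  simp [overMapMkId]

/-- A compatible family of predicates on the restrictions of `F` to a sieve has an
amalgamation. -/
lemma IsCompatible.exists_amalgamation (hα : IsCompatible α) :
    ∃ β : F ⟶ sheafOmega (J.over A), ∀ ⦃B : C⦄ (k : B ⟶ A) (hk : S k),
      (overRestrict J k).obj ⟨F, β⟩ = ⟨_, α k hk⟩ := by
  refine ⟨charOf F (GlueHolds α) fun Z W f x hx => GlueHolds.map hα f x hx, fun B k hk => ?_⟩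
  refine congrArg (SheafPred.mk _) (char_ext fun W x => ?_)
  refine (holds_restrict (Over.map k) (J.over_map_coverPreserving k) ⟨F, _⟩ x).trans ?_
  refine (holds_charOf _ _ _ _).trans ?_
  refine (functorPullback_overMap_mem_iff J k W _).symm.trans ⟨fun h => ?_, fun h => ?_⟩
  · refine holds_of_mem _ _ h fun V f hf => ?_
    exact (glueHolds_iff hα k hk V _).1 hf
  · refine (J.over B).superset_covering ?_ ((J.over B).top_mem W)
    intro V f _
    exact (glueHolds_iff hα k hk V _).2 (h.map f)

end Amalgamation

/-- A compatible family of predicates whose carriers are equal to the restrictions of `F` to a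
sieve has an amalgamation with carrier `F`. -/
lemma exists_amalgamation {S : Sieve A} {F : Sheaf (J.over A) (Type u)}
    (P : ∀ ⦃B : C⦄ (k : B ⟶ A), S k → SheafPred (J.over B))
    (hP : ∀ ⦃B : C⦄ (k : B ⟶ A) (hk : S k), (P k hk).carrier = (sheafRestrict J k).obj F)
    (hP' : ∀ ⦃B D : C⦄ (k : B ⟶ A) (hk : S k) (m : D ⟶ B),
      (overRestrict J m).obj (P k hk) = P (m ≫ k) (S.downward_closed hk m)) :
    ∃ Q : SheafPred (J.over A), Q.carrier = F ∧ ∀ ⦃B : C⦄ (k : B ⟶ A) (hk : S k),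
      (overRestrict J k).obj Q = P k hk := by
  have h ⦃B : C⦄ (k : B ⟶ A) (hk : S k) :
      ∃ α : (sheafRestrict J k).obj F ⟶ sheafOmega (J.over B), P k hk = ⟨_, α⟩ := by
    rw [← hP k hk]
    exact ⟨_, rfl⟩
  choose α h using h
  obtain ⟨β, hβ⟩ := IsCompatible.exists_amalgamation (α := α)
    (fun B D k hk m => by rw [← h, ← h, hP'])
  exact ⟨⟨F, β⟩, rfl, fun B k hk => (hβ k hk).trans (h k hk).symm⟩

end Glue

end SheafPred

/-! ### The fibres are internal to sheaves -/

section Fibres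

variable {C : Type u} [SmallCategory C]

lemma pullback_elem_ext {K : Type u} [SmallCategory K] {F G H : K ⥤ Type v}
    (f : F ⟶ H) (g : G ⟶ H) [HasPullback f g] {A : K} {w w' : (pullback f g).obj A}
    (h₁ : (pullback.fst f g).app A w = (pullback.fst f g).app A w')
    (h₂ : (pullback.snd f g).app A w = (pullback.snd f g).app A w') : w = w' :=
  Types.ext_of_isPullback ((IsPullback.of_hasPullback f g).map ((evaluation K (Type v)).obj A))
    h₁ h₂

lemma exists_pullback_elem {K : Type u} [SmallCategory K] {F G H : K ⥤ Type v}
    (f : F ⟶ H) (g : G ⟶ H) [HasPullback f g] {A : K} (x : F.obj A) (y : G.obj A)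
    (h : f.app A x = g.app A y) : ∃ w : (pullback f g).obj A, (pullback.fst f g).app A w = x ∧
      (pullback.snd f g).app A w = y :=
  Types.exists_of_isPullback ((IsPullback.of_hasPullback f g).map ((evaluation K (Type v)).obj A))
    x y h

/-- A terminal presheaf has exactly one element at each stage. -/
noncomputable instance terminalElemUnique (A : Cᵒᵖ) :
    Unique ((⊤_ (Cᵒᵖ ⥤ Type (u + 1))).obj A) :=
  Types.isTerminalEquivUnique _
    (IsTerminal.isTerminalObj ((evaluation _ (Type (u + 1))).obj A) _ terminalIsTerminal)

variable (J : GrothendieckTopology C) (X : ⊤_ (Cᵒᵖ ⥤ Type (u + 1)) ⟶ (Univ J).obj₀)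

/-- The sheaf on the slice over `A` that is the value at `A` of a global section. -/
noncomputable def sectionSheaf (A : C) : Sheaf (J.over A) (Type u) :=
  X.app (op A) default

lemma sectionSheaf_restrict {A B : C} (k : B ⟶ A) :
    (SheafPred.sheafRestrict J k).obj (sectionSheaf J X A) = sectionSheaf J X B :=
  (natTrans_app_map X k.op default).symm.trans (congrArg (X.app (op B)) (Subsingleton.elim _ _))

/-- The predicate underlying an element of the fibre. -/
noncomputable def fibrePred {A : C} (w : ((predFunctor J).fibre X).obj₀.obj (op A)) :
    SheafPred (J.over A) :=
  ((predFunctor J).fibreι X).f₀.app (op A) w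

/-- The morphism of predicates underlying a morphism of the fibre. -/
noncomputable def fibreArrow {A : C} (w : ((predFunctor J).fibre X).obj₁.obj (op A)) :
    Arrow (SheafPred (J.over A)) :=
  ((predFunctor J).fibreι X).f₁.app (op A) w

variable {J X} {A : C}

lemma fibrePred_carrier (w : ((predFunctor J).fibre X).obj₀.obj (op A)) :
    (fibrePred J X w).carrier = sectionSheaf J X A :=
  (pullback_app_condition (predFunctor J).f₀ X (op A) w).trans
    (congrArg (X.app (op A)) (Subsingleton.elim _ _))

lemma forget_fibreArrow (w : ((predFunctor J).fibre X).obj₁.obj (op A)) :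
    (SheafPred.forget (J.over A)).mapArrow.obj (fibreArrow J X w) =
      Arrow.mk (𝟙 (sectionSheaf J X A)) :=
  (pullback_app_condition (predFunctor J).f₁ (X ≫ (Univ J).e) (op A) w).trans
    (congrArg ((X ≫ (Univ J).e).app (op A)) (Subsingleton.elim _ default))

lemma fibrePred_injective {w w' : ((predFunctor J).fibre X).obj₀.obj (op A)}
    (h : fibrePred J X w = fibrePred J X w') : w = w' :=
  pullback_elem_ext (predFunctor J).f₀ X h (Subsingleton.elim _ _)

lemma fibreArrow_injective {w w' : ((predFunctor J).fibre X).obj₁.obj (op A)}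
    (h : fibreArrow J X w = fibreArrow J X w') : w = w' :=
  pullback_elem_ext (predFunctor J).f₁ (X ≫ (Univ J).e) h (Subsingleton.elim _ _)

lemma exists_fibrePred (P : SheafPred (J.over A)) (h : P.carrier = sectionSheaf J X A) :
    ∃ w, fibrePred J X w = P := by
  obtain ⟨w, hw, -⟩ := exists_pullback_elem (predFunctor J).f₀ X (A := op A) P default h
  exact ⟨w, hw⟩

lemma exists_fibreArrow (a : Arrow (SheafPred (J.over A)))
    (h : (SheafPred.forget (J.over A)).mapArrow.obj a = Arrow.mk (𝟙 (sectionSheaf J X A))) :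
    ∃ w, fibreArrow J X w = a := by
  obtain ⟨w, hw, -⟩ := exists_pullback_elem (predFunctor J).f₁ (X ≫ (Univ J).e) (A := op A) a
    default h
  exact ⟨w, hw⟩

lemma fibrePred_map {B : C} (k : B ⟶ A) (w : ((predFunctor J).fibre X).obj₀.obj (op A)) :
    fibrePred J X (((predFunctor J).fibre X).obj₀.map k.op w) =
      (SheafPred.overRestrict J k).obj (fibrePred J X w) :=
  natTrans_app_map ((predFunctor J).fibreι X).f₀ k.op w

lemma fibreArrow_map {B : C} (k : B ⟶ A) (w : ((predFunctor J).fibre X).obj₁.obj (op A)) :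
    fibreArrow J X (((predFunctor J).fibre X).obj₁.map k.op w) =
      (SheafPred.overRestrict J k).mapArrow.obj (fibreArrow J X w) :=
  natTrans_app_map ((predFunctor J).fibreι X).f₁ k.op w

lemma fibreArrow_left (w : ((predFunctor J).fibre X).obj₁.obj (op A)) :
    (fibreArrow J X w).left = fibrePred J X (((predFunctor J).fibre X).s.app (op A) w) :=
  congrArg (fun k : ((predFunctor J).fibre X).obj₁ ⟶ (Pred J).obj₀ => k.app (op A) w)
    ((predFunctor J).fibreι X).comm_s

lemma fibreArrow_right (w : ((predFunctor J).fibre X).obj₁.obj (op A)) :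
    (fibreArrow J X w).right = fibrePred J X (((predFunctor J).fibre X).t.app (op A) w) :=
  congrArg (fun k : ((predFunctor J).fibre X).obj₁ ⟶ (Pred J).obj₀ => k.app (op A) w)
    ((predFunctor J).fibreι X).comm_t

variable (J X)

lemma fibre_isSheaf_obj₀ : Presieve.IsSheaf J ((predFunctor J).fibre X).obj₀ := by
  intro A S hS
  rw [← Presieve.isSeparatedFor_and_exists_isAmalgamation_iff_isSheafFor]
  refine ⟨fun x w w' hw hw' => fibrePred_injective ?_, fun x hx => ?_⟩
  · refine SheafPred.eq_of_local (by rw [fibrePred_carrier, fibrePred_carrier]) hS ?_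
    intro B k hk
    rw [← fibrePred_map, ← fibrePred_map, hw k hk, hw' k hk]
  · rw [Presieve.compatible_iff_sieveCompatible] at hx
    obtain ⟨Q, hQ, hQ'⟩ := SheafPred.exists_amalgamation (F := sectionSheaf J X A)
      (fun B k hk => fibrePred J X (x k hk))
      (fun B k hk => by rw [fibrePred_carrier, sectionSheaf_restrict])
      (fun B D k hk m => by rw [← fibrePred_map, hx])
    obtain ⟨w, rfl⟩ := exists_fibrePred Q hQ
    refine ⟨w, fun B k hk => fibrePred_injective ?_⟩
    rw [fibrePred_map, hQ' k hk]

lemma fibre_isSheaf_obj₁ : Presieve.IsSheaf J ((predFunctor J).fibre X).obj₁ := by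
  have h₀ := fibre_isSheaf_obj₀ J X
  -- A morphism of the fibre is determined by its ends, so all equalities of morphisms below
  -- reduce to the sheaf condition on objects.
  have key {A : C} {w w' : ((predFunctor J).fibre X).obj₁.obj (op A)}
      (hl : (fibreArrow J X w).left = (fibreArrow J X w').left)
      (hr : (fibreArrow J X w).right = (fibreArrow J X w').right) : w = w' :=
    fibreArrow_injective
      (SheafPred.arrow_ext hl hr (by rw [forget_fibreArrow, forget_fibreArrow]))
  intro A S hS
  rw [← Presieve.isSeparatedFor_and_exists_isAmalgamation_iff_isSheafFor]
  refine ⟨fun x w w' hw hw' => key ?_ ?_, fun x hx => ?_⟩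
  · rw [fibreArrow_left, fibreArrow_left]
    refine congrArg _ ((h₀ S hS).isSeparatedFor.ext fun B k hk => ?_)
    rw [← natTrans_app_map, ← natTrans_app_map, hw k hk, hw' k hk]
  · rw [fibreArrow_right, fibreArrow_right]
    refine congrArg _ ((h₀ S hS).isSeparatedFor.ext fun B k hk => ?_)
    rw [← natTrans_app_map, ← natTrans_app_map, hw k hk, hw' k hk]
  · obtain ⟨w₁, hw₁, -⟩ := h₀ S hS _ (hx.map ((predFunctor J).fibre X).s)
    obtain ⟨w₂, hw₂, -⟩ := h₀ S hS _ (hx.map ((predFunctor J).fibre X).t)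
    have h₁ ⦃B : C⦄ (k : B ⟶ A) (hk : S k) : (fibreArrow J X (x k hk)).left =
        (SheafPred.overRestrict J k).obj (fibrePred J X w₁) := by
      rw [fibreArrow_left, ← fibrePred_map]
      exact congrArg _ (hw₁ k hk).symm
    have h₂ ⦃B : C⦄ (k : B ⟶ A) (hk : S k) : (fibreArrow J X (x k hk)).right =
        (SheafPred.overRestrict J k).obj (fibrePred J X w₂) := by
      rw [fibreArrow_right, ← fibrePred_map]
      exact congrArg _ (hw₂ k hk).symm
    obtain ⟨a, hal, har, ha⟩ := SheafPred.exists_vertical_of_local (fibrePred_carrier w₁)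
      (fibrePred_carrier w₂) hS fun B k hk => ⟨_, h₁ k hk, h₂ k hk, by
        rw [forget_fibreArrow, sectionSheaf_restrict]⟩
    obtain ⟨w, rfl⟩ := exists_fibreArrow a ha
    refine ⟨w, fun B k hk => key ?_ ?_⟩
    · rw [h₁ k hk, fibreArrow_map, ← hal]
      rfl
    · rw [h₂ k hk, fibreArrow_map, ← har]
      rfl

lemma fibre_isSheaf : ((predFunctor J).fibre X).IsSheaf J :=
  ⟨(isSheaf_iff_isSheaf_of_type J _).2 (fibre_isSheaf_obj₀ J X),
    (isSheaf_iff_isSheaf_of_type J _).2 (fibre_isSheaf_obj₁ J X)⟩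

end Fibres

/-! ### Quantification along a global morphism of sheaves -/

theorem mainTheorem4 {C : Type u} [SmallCategory C] (J : GrothendieckTopology C)
    (X Y : ⊤_ (Cᵒᵖ ⥤ Type (u + 1)) ⟶ (Univ J).obj₀)
    (f : ⊤_ (Cᵒᵖ ⥤ Type (u + 1)) ⟶ (Univ J).obj₁)
    (hs : f ≫ (Univ J).s = X) (ht : f ≫ (Univ J).t = Y) :
    -- the fibres are categories internal to sheaves
    ((predFunctor J).fibre X).IsSheaf J ∧ ((predFunctor J).fibre Y).IsSheaf J ∧
    -- reindexing, from a cartesian 2-cell over `f`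
    (∃! reindex : IntFunctor ((predFunctor J).fibre Y) ((predFunctor J).fibre X),
      ∃ α : IntNatTrans (reindex.comp ((predFunctor J).fibreι X)) ((predFunctor J).fibreι Y),
        IntNatTrans.IsCartesian (predFunctor J) α ∧
        (α.whiskerRight (predFunctor J)).app = terminal.from _ ≫ f) ∧
    -- existential quantification, from an opcartesian 2-cell over `f`
    (∃! exist : IntFunctor ((predFunctor J).fibre X) ((predFunctor J).fibre Y),
      ∃ α : IntNatTrans ((predFunctor J).fibreι X) (exist.comp ((predFunctor J).fibreι Y)),
        IntNatTrans.IsOpcartesian (predFunctor J) α ∧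
        (α.whiskerRight (predFunctor J)).app = terminal.from _ ≫ f) := by
  refine ⟨fibre_isSheaf J X, fibre_isSheaf J Y, ?_, ?_⟩
  · obtain ⟨a, hat, hap, ha⟩ := exists_cartesian_lift ((predFunctor J).fibreι Y).f₀
      (terminal.from _ ≫ f) (by rw [IntFunctor.fibreι_f₀_comp, Category.assoc, ht])
    exact IntFunctor.existsUnique_reindex (predFunctor_isFaithful J)
      (predFunctor_isFibrewiseAntisymm J) hs ht a hat hap ha
  · obtain ⟨a, has, hap, ha⟩ := exists_opcartesian_lift ((predFunctor J).fibreι X).f₀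
      (terminal.from _ ≫ f) (by rw [IntFunctor.fibreι_f₀_comp, Category.assoc, hs])
    exact IntFunctor.existsUnique_exist (predFunctor_isFaithful J)
      (predFunctor_isFibrewiseAntisymm J) hs ht a has hap ha
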